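/- Setting. Let $\psi:\mathbb R\to\mathbb R$ be measurable and $1$-periodic with finite total variation $\|\psi\|_{BV}=\sup\sum_j|\psi(x_j)-\psi(x_{j-1})|$ on $[0,1]$ (supremum over partitions of $[0,1]$). Let $\mu$ be a Borel probability measure on $\mathbb R$, absolutely continuous with respect to Lebesgue measure, let $R>0$, $A\sim\mathcal N(0,R^2)$, and let the random target function be $h(x)=\psi(Ax)$; $\mathrm{Var}_h$ is the variance with respect to $A$. Let $O\subseteq\mathbb R^N$ be open, $p:O\times\mathbb R\to\mathbb R$ and $L:\mathbb R\times\mathbb R\to\mathbb R$ measurable, with $L(p(w,x),\psi(ax))$ bounded over $w\in O$ and $x,a\in\mathbb R$. Assume that there is a constant $K$ such that every $w\in O$ has a neighbourhood $U$ for which, for $\mu$-almost every $x$, $p(\cdot,x)$ is $K$-Lipschitz on $U$ and, for every $y\in\mathbb R$, $L(\cdot,y)$ is $K$-Lipschitz on $\{p(v,x):v\in U\}$. Put $C_h(w)=\mathbb E_{X\sim\mu}[L(p(w,X),h(X))]$ and $\|\partial_{w_i}p(w,\cdot)\|^2_\mu=\mathbb E_{X\sim\mu}[(\partial_{w_i}p(w,X))^2]$.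 Theorem. For every $c>0$ there is a constant $\alpha>0$, depending only on $c$, such that the following holds in every such setting, for every index $i$ and every $w\in O$ with the property that, for $\mu$-almost every $x$, $\partial_{w_i}p(w,x)$ exists and, for all $y\in\mathbb R$, the derivatives $\partial_pL$, $\partial_y\partial_pL$, $\partial_y^2\partial_pL$ exist at $(p(w,x),y)$ and are bounded in absolute value by $c$. The partial derivative $\partial_{w_i}C_h(w)$ exists for every $h=\psi(a\,\cdot)$, $a\in\mathbb R$, it is square integrable in the random choice of $h$, and $$\mathrm{Var}_h[\partial_{w_i}C_h(w)]\le\alpha\,\|\partial_{w_i}p(w,\cdot)\|^2_\mu\,\max(\|\psi\|_{BV},\|\psi\|_{BV}^2)\,\min_{H\in\mathbb N,\,H\ge1}\Bigl(\frac1{H^2}+\log^2(H+1)\sum_{\substack{a,b\in\mathbb Z,\ |a|,|b|\le H\\(a,b)\ne(0,0)}}\frac{\mathbb E_{(X,Y)\sim\mu\times\mu}[e^{-2\pi^2R^2(aX+bY)^2}]}{\max(|a|,1)\max(|b|,1)}\Bigr)^{1/2}.$$ Moreover, if $\mu$ is the uniform distribution on $[0,1]$ and $R\ge1$, then $$\mathrm{Var}_h[\partial_{w_i}C_h(w)]\le\alpha\,\|\partial_{w_i}p(w,\cdot)\|^2_\mu\,\max(\|\psi\|_{BV},\|\psi\|_{BV}^2)\,\frac{\log^2(R+1)}{\sqrt{R+1}}.$$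 -/

import Mathlib

open MeasureTheory ProbabilityTheory Set Filter Topology
open scoped NNReal ENNReal

noncomputable section

/-- The target function `x ↦ ψ (a x)` with frequency `a`. -/
def waveTarget (ψ : ℝ → ℝ) (a : ℝ) : ℝ → ℝ := fun x => ψ (a * x)

/-- The law `N(0, R²)` of the random frequency `A`; the random target is `waveTarget ψ A`. -/
def frequencyLaw (R : ℝ) : Measure ℝ := gaussianReal 0 (Real.toNNReal (R ^ 2))

/-- The objective `C_h(w) = E_{X ∼ μ} [L (p(w, X), h(X))]`. -/
def objective {N : ℕ} (L : ℝ → ℝ → ℝ) (p : EuclideanSpace ℝ (Fin N) → ℝ → ℝ)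
    (μ : Measure ℝ) (h : ℝ → ℝ) (w : EuclideanSpace ℝ (Fin N)) : ℝ :=
  ∫ x, L (p w x) (h x) ∂μ

/-- The partial derivative of `f` with respect to the `i`-th coordinate exists at `w`. -/
def HasPartial {N : ℕ} (f : EuclideanSpace ℝ (Fin N) → ℝ) (i : Fin N)
    (w : EuclideanSpace ℝ (Fin N)) : Prop :=
  LineDifferentiableAt ℝ f w (EuclideanSpace.single i (1 : ℝ))

/-- The partial derivative of `f` with respect to the `i`-th coordinate at `w`. -/
def partialDeriv {N : ℕ} (f : EuclideanSpace ℝ (Fin N) → ℝ) (i : Fin N)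
    (w : EuclideanSpace ℝ (Fin N)) : ℝ :=
  lineDeriv ℝ f w (EuclideanSpace.single i (1 : ℝ))

/-- The random variable (a function of the frequency `a`) `∂_{w_i} C_h(w)` with `h(x) = ψ(a x)`. -/
def gradCoord {N : ℕ} (L : ℝ → ℝ → ℝ) (p : EuclideanSpace ℝ (Fin N) → ℝ → ℝ)
    (μ : Measure ℝ) (ψ : ℝ → ℝ) (i : Fin N) (w : EuclideanSpace ℝ (Fin N)) (a : ℝ) : ℝ :=
  partialDeriv (objective L p μ (waveTarget ψ a)) i w

/-- The squared norm `‖∂_{w_i} p(w, ·)‖²` in `L²(μ)`. -/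
def sqNormPartial {N : ℕ} (p : EuclideanSpace ℝ (Fin N) → ℝ → ℝ)
    (μ : Measure ℝ) (i : Fin N) (w : EuclideanSpace ℝ (Fin N)) : ℝ :=
  ∫ x, (partialDeriv (fun v => p v x) i w) ^ 2 ∂μ

/-- The total variation of `ψ` on `[0,1]` (a real number when `ψ` has bounded variation there). -/
def bvNorm (ψ : ℝ → ℝ) : ℝ := (eVariationOn ψ (Icc (0 : ℝ) 1)).toReal

/-- `∂L(q, y)/∂q`, the derivative of the loss in its first argument. -/
def lossDeriv (L : ℝ → ℝ → ℝ) (q y : ℝ) : ℝ := deriv (fun q' => L q' y) q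

/-- The nonzero integer pairs `(a, b)` with `|a|, |b| ≤ H`. -/
def nonzeroPairs (H : ℕ) : Finset (ℤ × ℤ) :=
  (Finset.Icc (-(H : ℤ)) H ×ˢ Finset.Icc (-(H : ℤ)) H).erase (0, 0)

/-- `1/H² + log²(H+1) ∑_{(a,b) ≠ 0, |a|,|b| ≤ H}
E[exp(-2π²R²(aX+bY)²)] / (max(|a|,1) max(|b|,1))` with `X, Y` independent of law `μ`. -/
def discrepancyBound (μ : Measure ℝ) (R : ℝ) (H : ℕ) : ℝ :=
  1 / (H : ℝ) ^ 2 + Real.log ((H : ℝ) + 1) ^ 2 *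
    ∑ ab ∈ nonzeroPairs H,
      (∫ z : ℝ × ℝ, Real.exp (-2 * Real.pi ^ 2 * R ^ 2 * ((ab.1 : ℝ) * z.1 + (ab.2 : ℝ) * z.2) ^ 2)
          ∂(μ.prod μ)) /
        (max |(ab.1 : ℝ)| 1 * max |(ab.2 : ℝ)| 1)

/-- The assumptions on the model `p`, the loss `L` and the profile `ψ` under which the objective is
considered: measurability, boundedness of the loss along the targets, and (so that almost everywhere
existing, bounded derivatives control the functions) Lipschitz continuity near every parameter, with
one constant, of `p(·, x)` and of `L(·, y)` on the values taken by `p(·, x)`. -/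
structure StandingAssumptions {N : ℕ} (O : Set (EuclideanSpace ℝ (Fin N)))
    (p : EuclideanSpace ℝ (Fin N) → ℝ → ℝ) (L : ℝ → ℝ → ℝ) (ψ : ℝ → ℝ) (μ : Measure ℝ) : Prop where
  isOpen : IsOpen O
  measurable_p : Measurable (fun z : O × ℝ => p z.1 z.2)
  measurable_L : Measurable (fun z : ℝ × ℝ => L z.1 z.2)
  measurable_ψ : Measurable ψ
  periodic_ψ : Function.Periodic ψ 1
  bounded_loss : ∃ B : ℝ, ∀ w ∈ O, ∀ x a : ℝ, |L (p w x) (waveTarget ψ a x)| ≤ B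
  lipschitz : ∃ K : ℝ≥0, ∀ w ∈ O, ∃ U ∈ 𝓝 w, ∀ᵐ x ∂μ,
    LipschitzOnWith K (fun v => p v x) U ∧
    ∀ y : ℝ, LipschitzOnWith K (fun q => L q y) ((fun v => p v x) '' U)

/-- At the parameter `w`, for almost every input `x`, the derivatives `∂p/∂w_i(w, x)` and, for all
`y`, `∂L/∂p`, `∂²L/∂p∂y`, `∂³L/∂p∂y²` at `(p(w, x), y)` exist, and the last three are bounded in
absolute value by `c`. -/
def DerivativeBounds {N : ℕ} (p : EuclideanSpace ℝ (Fin N) → ℝ → ℝ) (L : ℝ → ℝ → ℝ)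
    (μ : Measure ℝ) (i : Fin N) (w : EuclideanSpace ℝ (Fin N)) (c : ℝ) : Prop :=
  ∀ᵐ x ∂μ, HasPartial (fun v => p v x) i w ∧
    (∀ y, DifferentiableAt ℝ (fun q => L q y) (p w x)) ∧
    Differentiable ℝ (fun y => lossDeriv L (p w x) y) ∧
    Differentiable ℝ (deriv (fun y => lossDeriv L (p w x) y)) ∧
    (∀ y, |lossDeriv L (p w x) y| ≤ c) ∧
    (∀ y, |deriv (fun y' => lossDeriv L (p w x) y') y| ≤ c) ∧
    (∀ y, |deriv (deriv (fun y' => lossDeriv L (p w x) y')) y| ≤ c)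

end

/-! Differentiating under the integral gives `∂_{w_i} C_h(w) = E_X[Φ(X, ψ(aX)) g(X)]`, where `Φ(x,
y)` is `∂_p L` at `(p(w,x), y)` and `g` is `∂_{w_i} p(w, ·)` (`exists_representation`). Since `Φ` is
`c`-Lipschitz in `y`, `t ↦ Φ(x, ψ(t))` is 1-periodic with variation at most `cV`, where `V =
‖ψ‖_BV`. Let `f_x` be this function minus its mean over a period. The subtracted means contribute a
constant to the gradient, so the variance is at most the double integral over `(x, y)` of `g(x) g(y)
E_a[f_x(ax) f_y(ay)]`.

The inner expectation measures how far the two phases `ax`, `ay` are from being independent and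
uniform modulo one. An Erdős–Turán–Koksma type inequality (`abs_integral_mul_le_coeffSum`) bounds it
by `c²V²` times `1/H` plus a weighted sum of the Fourier coefficients of the joint law of the
phases. For Gaussian `a` these coefficients are exactly the exponentials in the theorem
(`coeffSum_frequencyLaw`). Cauchy–Schwarz in `(x, y)` then splits off `‖g‖²` and leaves the `L²`
norm of the discrepancy. Its square is linearised by the fact that every Gaussian weight is at most
one (`gaussWeightSum_sq_le`), which produces the factor `log²(H+1)` and the square root.

The Erdős–Turán–Koksma bound convolves each function with a non-negative kernel of degree `H`, mass
one and second moment `O(H⁻²)`. The convolutions are trigonometric polynomials, whose correlation is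
read off from Fourier coefficients. The `L¹` error of a convolution is governed by the largest
probability of an arc of length `1/(2H)`, because a function of bounded variation changes little on
most arcs (`PeriodicVariation.integral_abs_sub_smooth_le`). Arc probabilities are in turn bounded by
the same Fourier coefficients, through a Fejér kernel majorant (`measureReal_arc_le`).

For uniform inputs each Gaussian weight has mean at most `1/R`, and `H = ⌈R⌉` gives the explicit
rate. -/

/-! ### Characters and non-negative trigonometric kernels -/

/-- The additive character `x ↦ exp (2πix)`. -/
noncomputable def expi (x : ℝ) : ℂ := Complex.exp (((2 * Real.pi * x : ℝ) : ℂ) * Complex.I)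

lemma expi_add (x y : ℝ) : expi (x + y) = expi x * expi y := by
  unfold expi
  rw [← Complex.exp_add]
  congr 1
  push_cast
  ring

@[simp] lemma norm_expi (x : ℝ) : ‖expi x‖ = 1 := Complex.norm_exp_ofReal_mul_I _

@[simp] lemma expi_zero : expi 0 = 1 := by simp [expi]

@[simp] lemma expi_intCast (n : ℤ) : expi n = 1 := by
  unfold expi
  rw [← Complex.exp_int_mul_two_pi_mul_I n]
  congr 1
  push_cast
  ring

lemma conj_expi (x : ℝ) : (starRingEnd ℂ) (expi x) = expi (-x) := by
  unfold expi
  rw [← Complex.exp_conj, map_mul, Complex.conj_I, Complex.conj_ofReal]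
  congr 1
  push_cast
  ring

lemma expi_half : expi (1 / 2) = -1 := by
  unfold expi
  rw [← Complex.exp_pi_mul_I]
  congr 1
  push_cast
  ring

lemma re_expi (x : ℝ) : (expi x).re = Real.cos (2 * Real.pi * x) :=
  Complex.exp_ofReal_mul_I_re _

@[fun_prop] lemma continuous_expi : Continuous expi := by
  unfold expi
  fun_prop

@[fun_prop] lemma measurable_expi : Measurable expi := continuous_expi.measurable

lemma integral_expi (k : ℤ) :
    ∫ u in (-(1 / 2) : ℝ)..(1 / 2), expi (k * u) = if k = 0 then 1 else 0 := by
  split_ifs with hk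
  · subst hk
    norm_num
  · have hc : (2 * Real.pi * k * Complex.I : ℂ) ≠ 0 := by
      simp [hk, Real.pi_ne_zero]
    have h1 : ∀ u : ℝ, expi (k * u) = Complex.exp ((2 * Real.pi * k * Complex.I : ℂ) * u) := by
      intro u
      unfold expi
      congr 1
      push_cast
      ring
    simp_rw [h1]
    rw [integral_exp_mul_complex hc, ← h1, ← h1]
    have : expi (k * (1 / 2)) = expi (k * -(1 / 2)) := by
      rw [show (k : ℝ) * (1 / 2) = k * -(1 / 2) + k by ring, expi_add]
      simp
    rw [this]
    simp

/-- The non-negative trigonometric polynomial `|∑_{k ≤ H} p_k e(k u)|²`. -/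
noncomputable def sqKernel (p : ℕ → ℝ) (H : ℕ) (u : ℝ) : ℝ :=
  ‖∑ k ∈ Finset.range (H + 1), (p k : ℂ) * expi (k * u)‖ ^ 2

lemma sqKernel_nonneg (p : ℕ → ℝ) (H : ℕ) (u : ℝ) : 0 ≤ sqKernel p H u := by
  unfold sqKernel; positivity

@[fun_prop] lemma continuous_sqKernel (p : ℕ → ℝ) (H : ℕ) : Continuous (sqKernel p H) := by
  unfold sqKernel
  fun_prop

lemma sqKernel_eq (p : ℕ → ℝ) (H : ℕ) (u : ℝ) :
    (sqKernel p H u : ℂ) = ∑ k ∈ Finset.range (H + 1), ∑ l ∈ Finset.range (H + 1),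
      ((p k * p l : ℝ) : ℂ) * expi (((k : ℤ) - (l : ℤ) : ℤ) * u) := by
  unfold sqKernel
  rw [Complex.ofReal_pow, ← Complex.mul_conj', map_sum, Finset.sum_mul_sum]
  refine Finset.sum_congr rfl fun k _ => Finset.sum_congr rfl fun l _ => ?_
  rw [map_mul, Complex.conj_ofReal, conj_expi]
  have : expi (((k : ℤ) - (l : ℤ) : ℤ) * u) = expi (k * u) * expi (-(l * u)) := by
    rw [← expi_add]
    congr 1
    push_cast
    ring
  rw [this]
  push_cast
  ring

lemma integral_sqKernel_mul_expi (p : ℕ → ℝ) (H : ℕ) (m : ℤ) :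
    ∫ u in (-(1 / 2) : ℝ)..(1 / 2), (sqKernel p H u : ℂ) * expi (m * u) =
      ∑ k ∈ Finset.range (H + 1), ∑ l ∈ Finset.range (H + 1),
        if (k : ℤ) - l + m = 0 then ((p k * p l : ℝ) : ℂ) else 0 := by
  simp_rw [sqKernel_eq, Finset.sum_mul]
  rw [intervalIntegral.integral_finsetSum]
  · refine Finset.sum_congr rfl fun k _ => ?_
    rw [intervalIntegral.integral_finsetSum]
    · refine Finset.sum_congr rfl fun l _ => ?_
      simp_rw [mul_assoc, ← expi_add, ← add_mul, ← Int.cast_add]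
      rw [intervalIntegral.integral_const_mul, integral_expi]
      split_ifs <;> simp
    · intro l _
      apply Continuous.intervalIntegrable
      fun_prop
  · intro k _
    apply Continuous.intervalIntegrable
    fun_prop

lemma integral_sqKernel (p : ℕ → ℝ) (H : ℕ) :
    ∫ u in (-(1 / 2) : ℝ)..(1 / 2), sqKernel p H u = ∑ k ∈ Finset.range (H + 1), p k ^ 2 := by
  have h := integral_sqKernel_mul_expi p H 0
  simp only [Int.cast_zero, zero_mul, expi_zero, mul_one, add_zero] at h
  rw [intervalIntegral.integral_ofReal] at h
  apply Complex.ofReal_injective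
  rw [h]
  push_cast
  refine Finset.sum_congr rfl fun k hk => ?_
  rw [Finset.sum_eq_single k]
  · simp [sq]
  · intro l _ hl
    rw [if_neg]
    omega
  · intro h
    exact absurd hk h

lemma integral_sqKernel_mul_cos (p : ℕ → ℝ) (H : ℕ) :
    ∫ u in (-(1 / 2) : ℝ)..(1 / 2), sqKernel p H u * Real.cos (2 * Real.pi * u) =
      ∑ k ∈ Finset.range H, p k * p (k + 1) := by
  have h := integral_sqKernel_mul_expi p H 1
  have h2 : ∫ u in (-(1 / 2) : ℝ)..(1 / 2), sqKernel p H u * Real.cos (2 * Real.pi * u) =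
      (∫ u in (-(1 / 2) : ℝ)..(1 / 2), (sqKernel p H u : ℂ) * expi (((1 : ℤ) : ℝ) * u)).re := by
    have := intervalIntegral.intervalIntegral_re (𝕜 := ℂ) (μ := volume) (a := -(1 / 2)) (b := 1 / 2)
      (f := fun u => (sqKernel p H u : ℂ) * expi (((1 : ℤ) : ℝ) * u)) (by
        apply Continuous.intervalIntegrable
        fun_prop)
    simp only [RCLike.re_eq_complex_re] at this
    rw [← this]
    refine intervalIntegral.integral_congr fun u _ => ?_
    simp [re_expi]
  rw [h2, h, Finset.sum_range_succ, Complex.add_re, Complex.re_sum]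
  have h3 : ∑ l ∈ Finset.range (H + 1),
      (if (H : ℤ) - l + 1 = 0 then ((p H * p l : ℝ) : ℂ) else 0) = 0 := by
    refine Finset.sum_eq_zero fun l hl => ?_
    rw [if_neg]
    have := Finset.mem_range.1 hl
    omega
  rw [h3, Complex.zero_re, add_zero]
  refine Finset.sum_congr rfl fun k hk => ?_
  have := Finset.mem_range.1 hk
  rw [Finset.sum_eq_single (k + 1)]
  · rw [if_pos (by push_cast; ring), Complex.ofReal_re]
  · intro l _ hl
    rw [if_neg]
    omega
  · intro h
    exact absurd (Finset.mem_range.2 (by omega)) h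

/-- Coefficients of Fejér's extremal kernel. -/
lemma exists_extremal_coeff (H : ℕ) : ∃ p : ℕ → ℝ,
    ∑ k ∈ Finset.range (H + 1), p k ^ 2 = 1 ∧
    ∑ k ∈ Finset.range H, p k * p (k + 1) = Real.cos (Real.pi / (H + 2)) := by
  set θ : ℝ := Real.pi / (H + 2) with hθ
  -- Sines vanishing at `0` and `H + 2` form the top eigenvector of the adjacency matrix of the path
  -- on `H + 1` vertices, with eigenvalue `2 cos θ`. After normalisation the first Fourier
  -- coefficient of the kernel is `cos θ`.
  set q : ℕ → ℝ := fun j => Real.sin (j * θ) with hq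
  have hH : (0 : ℝ) < H + 2 := by positivity
  have q0 : q 0 = 0 := by simp [hq]
  have qend : q (H + 2) = 0 := by
    have : ((H + 2 : ℕ) : ℝ) * θ = Real.pi := by
      rw [hθ]; push_cast; field_simp
    simp only [hq, this, Real.sin_pi]
  have hrec : ∀ j : ℕ, 2 * Real.cos θ * q (j + 1) = q j + q (j + 2) := by
    intro j
    simp only [hq]
    have e1 : ((j : ℕ) : ℝ) * θ = ((j + 1 : ℕ) : ℝ) * θ - θ := by push_cast; ring
    have e2 : ((j + 2 : ℕ) : ℝ) * θ = ((j + 1 : ℕ) : ℝ) * θ + θ := by push_cast; ring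
    rw [e1, e2, Real.sin_sub, Real.sin_add]
    ring
  set Z := ∑ k ∈ Finset.range (H + 1), q (k + 1) ^ 2 with hZ
  have hZpos : 0 < Z := by
    have hq1 : 0 < q 1 := by
      simp only [hq, Nat.cast_one, one_mul]
      apply Real.sin_pos_of_pos_of_lt_pi
      · positivity
      · rw [hθ, div_lt_iff₀ hH]
        nlinarith [Real.pi_pos, (Nat.cast_nonneg H : (0 : ℝ) ≤ H)]
    calc 0 < q (0 + 1) ^ 2 := by positivity
      _ ≤ Z := Finset.single_le_sum (f := fun k => q (k + 1) ^ 2) (fun k _ => sq_nonneg _)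
          (Finset.mem_range.2 (Nat.succ_pos H))
  have key : ∑ k ∈ Finset.range H, q (k + 1) * q (k + 2) = Real.cos θ * Z := by
    have h1 : 2 * Real.cos θ * Z = ∑ k ∈ Finset.range (H + 1), q k * q (k + 1) +
        ∑ k ∈ Finset.range (H + 1), q (k + 1) * q (k + 2) := by
      rw [hZ, Finset.mul_sum, ← Finset.sum_add_distrib]
      refine Finset.sum_congr rfl fun k _ => ?_
      linear_combination q (k + 1) * hrec k
    rw [Finset.sum_range_succ' (fun k => q k * q (k + 1)), q0,
      Finset.sum_range_succ (fun k => q (k + 1) * q (k + 2)), qend] at h1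
    linarith
  refine ⟨fun k => q (k + 1) / Real.sqrt Z, ?_, ?_⟩
  · simp_rw [div_pow, Real.sq_sqrt hZpos.le]
    rw [← Finset.sum_div, div_self hZpos.ne']
  · have : ∀ k : ℕ, q (k + 1) / Real.sqrt Z * (q (k + 1 + 1) / Real.sqrt Z)
        = q (k + 1) * q (k + 2) / Z := by
      intro k
      rw [div_mul_div_comm, Real.mul_self_sqrt hZpos.le]
    simp_rw [this]
    rw [← Finset.sum_div, key, mul_div_assoc, div_self hZpos.ne', mul_one]

/-- Jordan's inequality for `sin (πu)`. It lets the first Fourier coefficient of a kernel control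
its second moment. -/
lemma eight_mul_sq_le_one_sub_cos {u : ℝ} (hu : |u| ≤ 1 / 2) :
    8 * u ^ 2 ≤ 1 - Real.cos (2 * Real.pi * u) := by
  have h1 : Real.cos (2 * Real.pi * u) = 1 - 2 * Real.sin (Real.pi * u) ^ 2 := by
    rw [mul_assoc, Real.cos_two_mul']
    nlinarith [Real.sin_sq_add_cos_sq (Real.pi * u)]
  have h2 : 2 * |u| ≤ |Real.sin (Real.pi * u)| := by
    have := Real.mul_abs_le_abs_sin (x := Real.pi * u) (by
      rw [abs_mul, abs_of_pos Real.pi_pos]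
      nlinarith [Real.pi_pos])
    rw [abs_mul, abs_of_pos Real.pi_pos] at this
    calc 2 * |u| = 2 / Real.pi * (Real.pi * |u|) := by field_simp
      _ ≤ _ := this
  have h3 : (2 * |u|) ^ 2 ≤ |Real.sin (Real.pi * u)| ^ 2 := by gcongr
  rw [sq_abs, mul_pow, sq_abs] at h3
  linarith

/-- A Jackson-type kernel: non-negative, of degree `H`, of mass one, with second moment
`O(H⁻²)`. -/
lemma exists_jackson_coeff {H : ℕ} (hH : 1 ≤ H) : ∃ p : ℕ → ℝ,
    ∑ k ∈ Finset.range (H + 1), p k ^ 2 = 1 ∧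
    ∫ u in (-(1 / 2) : ℝ)..(1 / 2), sqKernel p H u = 1 ∧
    ∫ u in (-(1 / 2) : ℝ)..(1 / 2), sqKernel p H u * (5 + 2 * (H : ℝ) ^ 2 * u ^ 2) ≤ 7 := by
  obtain ⟨p, hp1, hp2⟩ := exists_extremal_coeff H
  have hI : ∫ u in (-(1 / 2) : ℝ)..(1 / 2), sqKernel p H u = 1 := by
    rw [integral_sqKernel, hp1]
  have hC := integral_sqKernel_mul_cos p H
  rw [hp2] at hC
  refine ⟨p, hp1, hI, ?_⟩
  set J := sqKernel p H
  have hJc : Continuous J := continuous_sqKernel p H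
  have hHr : (1 : ℝ) ≤ H := by exact_mod_cast hH
  -- After this replacement the integral equals `5 + (H²/4)(1 - cos θ)` with `θ = π/(H+2)`. This is
  -- at most `5 + H²θ²/8 ≤ 7`, because `Hθ ≤ 4`.
  have step : ∫ u in (-(1 / 2) : ℝ)..(1 / 2), J u * (5 + 2 * (H : ℝ) ^ 2 * u ^ 2) ≤
      ∫ u in (-(1 / 2) : ℝ)..(1 / 2), ((5 + (H : ℝ) ^ 2 / 4) * J u -
        (H : ℝ) ^ 2 / 4 * (J u * Real.cos (2 * Real.pi * u))) := by
    refine intervalIntegral.integral_mono_on (by norm_num) ?_ ?_ ?_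
    · exact (by fun_prop : Continuous _).intervalIntegrable _ _
    · exact (by fun_prop : Continuous _).intervalIntegrable _ _
    · intro u hu
      have h8 := eight_mul_sq_le_one_sub_cos (u := u) (abs_le.2 ⟨by linarith [hu.1], hu.2⟩)
      have hJ0 : 0 ≤ J u := sqKernel_nonneg p H u
      have : 0 ≤ J u * (H : ℝ) ^ 2 / 4 * (1 - Real.cos (2 * Real.pi * u) - 8 * u ^ 2) := by
        apply mul_nonneg (by positivity)
        linarith
      linarith
  rw [intervalIntegral.integral_sub, intervalIntegral.integral_const_mul,
    intervalIntegral.integral_const_mul, hI, hC] at step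
  · refine step.trans ?_
    have hcos := Real.one_sub_sq_div_two_le_cos (x := Real.pi / (H + 2))
    have hb : (H : ℝ) ^ 2 * (Real.pi / (H + 2)) ^ 2 ≤ 16 := by
      rw [← mul_pow, ← mul_div_assoc]
      have h4 : (H : ℝ) * Real.pi / (H + 2) ≤ 4 := by
        rw [div_le_iff₀ (by positivity)]
        nlinarith [Real.pi_le_four]
      have h0 : 0 ≤ (H : ℝ) * Real.pi / (H + 2) := by positivity
      nlinarith
    nlinarith [sq_nonneg (H : ℝ), mul_le_mul_of_nonneg_left hcos (sq_nonneg (H : ℝ))]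
  · exact (by fun_prop : Continuous _).intervalIntegrable _ _
  · exact (by fun_prop : Continuous _).intervalIntegrable _ _

/-- Schur's test: `|p_k p_l|` is at most the mean of `p_k²` and `p_l²`, and each row or column of `f
(k - l)` runs over distinct integers in `[-H, H]`. It removes the kernel coefficients from every
later estimate. -/
lemma sum_sum_mul_le_sum_Icc (p : ℕ → ℝ) (H : ℕ) (f : ℤ → ℝ) (hf : ∀ m, 0 ≤ f m) :
    ∑ k ∈ Finset.range (H + 1), ∑ l ∈ Finset.range (H + 1), |p k * p l| * f ((k : ℤ) - l) ≤
      (∑ k ∈ Finset.range (H + 1), p k ^ 2) * ∑ m ∈ Finset.Icc (-(H : ℤ)) H, f m := by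
  have row : ∀ k ∈ Finset.range (H + 1), ∑ l ∈ Finset.range (H + 1), f ((k : ℤ) - l) ≤
      ∑ m ∈ Finset.Icc (-(H : ℤ)) H, f m := by
    intro k hk
    rw [← Finset.sum_image (f := f) (g := fun l : ℕ => (k : ℤ) - l) (by
      intro a _ b _ hab
      simp only at hab
      omega)]
    refine Finset.sum_le_sum_of_subset_of_nonneg ?_ fun m _ _ => hf m
    intro m hm
    obtain ⟨l, hl, rfl⟩ := Finset.mem_image.1 hm
    simp only [Finset.mem_range] at hk hl
    simp only [Finset.mem_Icc]
    omega
  have col : ∀ l ∈ Finset.range (H + 1), ∑ k ∈ Finset.range (H + 1), f ((k : ℤ) - l) ≤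
      ∑ m ∈ Finset.Icc (-(H : ℤ)) H, f m := by
    intro k hk
    rw [← Finset.sum_image (f := f) (g := fun l : ℕ => (l : ℤ) - k) (by
      intro a _ b _ hab
      simp only at hab
      omega)]
    refine Finset.sum_le_sum_of_subset_of_nonneg ?_ fun m _ _ => hf m
    intro m hm
    obtain ⟨l, hl, rfl⟩ := Finset.mem_image.1 hm
    simp only [Finset.mem_range] at hk hl
    simp only [Finset.mem_Icc]
    omega
  calc ∑ k ∈ Finset.range (H + 1), ∑ l ∈ Finset.range (H + 1), |p k * p l| * f ((k : ℤ) - l)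
      ≤ ∑ k ∈ Finset.range (H + 1), ∑ l ∈ Finset.range (H + 1),
        (p k ^ 2 / 2 * f ((k : ℤ) - l) + p l ^ 2 / 2 * f ((k : ℤ) - l)) := by
        refine Finset.sum_le_sum fun k _ => Finset.sum_le_sum fun l _ => ?_
        rw [← add_mul]
        refine mul_le_mul_of_nonneg_right ?_ (hf _)
        rw [abs_le]
        constructor <;> nlinarith [sq_nonneg (p k - p l), sq_nonneg (p k + p l)]
    _ = ∑ k ∈ Finset.range (H + 1), p k ^ 2 / 2 * ∑ l ∈ Finset.range (H + 1), f ((k : ℤ) - l) +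
        ∑ l ∈ Finset.range (H + 1), p l ^ 2 / 2 * ∑ k ∈ Finset.range (H + 1), f ((k : ℤ) - l) := by
        simp_rw [Finset.sum_add_distrib, Finset.mul_sum]
        congr 1
        exact Finset.sum_comm
    _ ≤ ∑ k ∈ Finset.range (H + 1), p k ^ 2 / 2 * ∑ m ∈ Finset.Icc (-(H : ℤ)) H, f m +
        ∑ l ∈ Finset.range (H + 1), p l ^ 2 / 2 * ∑ m ∈ Finset.Icc (-(H : ℤ)) H, f m := by
        gcongr with k hk l hl
        · exact row k hk
        · exact col l hl
    _ = _ := by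
        rw [← Finset.sum_mul, ← Finset.sum_div]
        ring

/-! ### Periodic functions of bounded variation and their shifts -/

/-- `F` is measurable, `1`-periodic, and its variation is controlled by the increments of `v`,
which grows by `V` over each period. -/
structure PeriodicVariation (F v : ℝ → ℝ) (V : ℝ) : Prop where
  measurable : Measurable F
  periodic : Function.Periodic F 1
  abs_sub_le : ∀ s t, s ≤ t → |F t - F s| ≤ v t - v s
  add_one : ∀ t, v (t + 1) = v t + V

namespace PeriodicVariation

variable {F v : ℝ → ℝ} {V : ℝ}

lemma monotone (h : PeriodicVariation F v V) : Monotone v := fun s t hst => by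
  linarith [abs_nonneg (F t - F s), h.abs_sub_le s t hst]

lemma nonneg (h : PeriodicVariation F v V) : 0 ≤ V := by
  linarith [h.add_one 0, h.monotone (show (0 : ℝ) ≤ 0 + 1 by norm_num)]

lemma abs_sub_le_of_mem (h : PeriodicVariation F v V) {a b s t : ℝ} (hs : s ∈ Icc a b)
    (ht : t ∈ Icc a b) : |F t - F s| ≤ v b - v a := by
  rcases le_total s t with hst | hst
  · linarith [h.abs_sub_le s t hst, h.monotone hs.1, h.monotone ht.2]
  · rw [abs_sub_comm]
    linarith [h.abs_sub_le t s hst, h.monotone ht.1, h.monotone hs.2]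

lemma abs_sub_le_total (h : PeriodicVariation F v V) (s t : ℝ) : |F t - F s| ≤ V := by
  have e : ∀ x, F (Int.fract x) = F x := fun x => by
    have := h.periodic.sub_int_mul_eq (x := x) ⌊x⌋
    rwa [mul_one] at this
  rw [← e s, ← e t]
  have := h.abs_sub_le_of_mem (a := 0) (b := 0 + 1)
    ⟨Int.fract_nonneg s, by linarith [Int.fract_lt_one s]⟩
    ⟨Int.fract_nonneg t, by linarith [Int.fract_lt_one t]⟩
  linarith [h.add_one 0]

lemma intervalIntegrable (h : PeriodicVariation F v V) (a b : ℝ) :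
    IntervalIntegrable F volume a b := by
  rw [intervalIntegrable_iff]
  refine Measure.integrableOn_of_bounded (M := |F 0| + V) (by simp) h.measurable.aestronglyMeasurable
    (ae_of_all _ fun x => ?_)
  have := h.abs_sub_le_total 0 x
  rw [Real.norm_eq_abs]
  linarith [abs_sub_abs_le_abs_sub (F x) (F 0)]

/-- With mean zero, `F t` is the average of `F t - F u` over a period. -/
lemma abs_le_total (h : PeriodicVariation F v V)
    (h0 : ∫ u in (-(1 / 2) : ℝ)..(1 / 2), F u = 0) (t : ℝ) : |F t| ≤ V := by
  have e : F t = ∫ u in (-(1 / 2) : ℝ)..(1 / 2), (F t - F u) := by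
    rw [intervalIntegral.integral_sub (by simp) (h.intervalIntegrable _ _), h0]
    norm_num
  rw [e]
  have := intervalIntegral.norm_integral_le_of_norm_le_const (a := -(1 / 2)) (b := 1 / 2)
    (f := fun u => F t - F u) (C := V) (fun u _ => h.abs_sub_le_total u t)
  norm_num at this
  norm_num
  exact this

end PeriodicVariation

/-- Windows of `r` consecutive cells placed at all `M` positions around the circle cover each cell
exactly `r` times. -/
lemma sum_range_shift_sub {b : ℤ → ℝ} {M : ℕ} {V : ℝ} (hb : ∀ j, b (j + M) = b j + V) (a : ℤ)
    (r : ℕ) : ∑ j ∈ Finset.range M, (b (j + a + r) - b (j + a)) = r * V := by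
  induction r with
  | zero => simp
  | succ r ih =>
    have h1 : ∑ j ∈ Finset.range M, (b ((j + 1 : ℕ) + a + r) - b ((j : ℕ) + a + r)) = V := by
      rw [Finset.sum_range_sub (fun j : ℕ => b (j + a + r))]
      have := hb (a + r)
      rw [show ((M : ℕ) : ℤ) + a + r = a + r + M by ring, this]
      simp
    have h2 : ∀ j : ℕ, b (j + a + (r + 1 : ℕ)) - b (j + a) =
        (b ((j + 1 : ℕ) + a + r) - b ((j : ℕ) + a + r)) + (b (j + a + r) - b (j + a)) := by
      intro j
      rw [show ((j + 1 : ℕ) : ℤ) + a + r = j + a + (r + 1 : ℕ) by push_cast; ring]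
      ring
    simp_rw [h2]
    rw [Finset.sum_add_distrib, h1, ih]
    push_cast
    ring

/-- The points within distance `1 / (2M)` of `θ` modulo one. -/
def arc (θ : ℝ) (M : ℕ) : Set ℝ := {t | ∃ n : ℤ, |t - θ - n| ≤ 1 / (2 * M)}

lemma measurableSet_arc (θ : ℝ) (M : ℕ) : MeasurableSet (arc θ M) := by
  have : arc θ M = ⋃ n : ℤ, {t | |t - θ - n| ≤ 1 / (2 * M)} := by
    ext t; simp [arc]
  rw [this]
  refine MeasurableSet.iUnion fun n => ?_
  exact measurableSet_le (by fun_prop) (by fun_prop)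

section Shift

variable {Ω : Type*} [MeasurableSpace Ω] {P : Measure Ω} [IsProbabilityMeasure P] {S : Ω → ℝ}
  {F v : ℝ → ℝ} {V : ℝ}

/-- The arc with index `j` is the closed cell `[j/M, (j+1)/M]` modulo one. If `t` lies in it, then
`t` and `t - u` both lie in the cell enlarged by `m` cells on each side. Cells sharing an endpoint
only enlarge the sum. -/
lemma PeriodicVariation.abs_sub_shift_le (h : PeriodicVariation F v V) {M : ℕ} (hM : 0 < M)
    {m : ℕ} {u : ℝ} (hu : |u| ≤ m / M) (t : ℝ) :
    |F t - F (t - u)| ≤ ∑ j ∈ Finset.range M,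
      (arc ((j + 1 / 2) / M) M).indicator
        (fun _ => v ((j + 1 + m) / M) - v ((j - m) / M)) t := by
  have hM' : (0 : ℝ) < M := by exact_mod_cast hM
  have hmono : ∀ j : ℕ, 0 ≤ v ((j + 1 + m) / M) - v (((j : ℝ) - m) / M) := by
    intro j
    rw [sub_nonneg]
    apply h.monotone
    gcongr
    have : (0 : ℝ) ≤ m := Nat.cast_nonneg m
    linarith
  set f := Int.fract t with hf
  have hf0 : 0 ≤ f := Int.fract_nonneg t
  have hf1 : f < 1 := Int.fract_lt_one t
  set j := ⌊(M : ℝ) * f⌋₊ with hj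
  have hj1 : (j : ℝ) ≤ M * f := Nat.floor_le (by positivity)
  have hj2 : (M : ℝ) * f < j + 1 := Nat.lt_floor_add_one _
  have hjM : j < M := by
    have : (j : ℝ) < M := lt_of_le_of_lt hj1 (by nlinarith)
    exact_mod_cast this
  have hmem : t ∈ arc (((j : ℝ) + 1 / 2) / M) M := by
    refine ⟨⌊t⌋, ?_⟩
    have e : t - ((j : ℝ) + 1 / 2) / M - ⌊t⌋ = (M * f - j - 1 / 2) / M := by
      have : t = ⌊t⌋ + f := (Int.floor_add_fract t).symm
      field_simp
      rw [hf, Int.fract]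
      ring
    rw [e, abs_div, abs_of_pos hM', div_le_div_iff₀ hM' (by positivity)]
    have : |(M : ℝ) * f - j - 1 / 2| ≤ 1 / 2 := by
      rw [abs_le]; constructor <;> linarith
    nlinarith
  have hu' := abs_le.1 hu
  have k1 : (j : ℝ) / M ≤ f := by rw [div_le_iff₀ hM']; linarith
  have k2 : f ≤ ((j : ℝ) + 1) / M := by rw [le_div_iff₀ hM']; linarith
  have e1 : ((j : ℝ) - m) / M = j / M - m / M := by ring
  have e2 : ((j : ℝ) + 1 + m) / M = (j + 1) / M + m / M := by ring
  have hm0 : (0 : ℝ) ≤ m / M := by positivity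
  have per : ∀ x : ℝ, F (x - ⌊t⌋) = F x := fun x => by
    simpa using h.periodic.sub_int_mul_eq (x := x) ⌊t⌋
  have e3 : F t = F f := by rw [hf, Int.fract, per]
  have e4 : F (t - u) = F (f - u) := by
    rw [hf, Int.fract, ← per (t - u)]
    congr 1
    ring
  have main : |F t - F (t - u)| ≤ v (((j : ℝ) + 1 + m) / M) - v (((j : ℝ) - m) / M) := by
    rw [e3, e4]
    refine h.abs_sub_le_of_mem ⟨?_, ?_⟩ ⟨?_, ?_⟩ <;> linarith
  refine main.trans ?_
  have := Finset.single_le_sum (s := Finset.range M) (f := fun j : ℕ =>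
      (arc (((j : ℝ) + 1 / 2) / M) M).indicator
        (fun _ => v ((j + 1 + m) / M) - v ((j - m) / M)) t)
      (fun j _ => indicator_nonneg (fun _ _ => hmono j) t) (Finset.mem_range.2 hjM)
  rwa [indicator_of_mem hmem] at this

lemma PeriodicVariation.integral_abs_sub_shift_le (h : PeriodicVariation F v V) {M : ℕ}
    (hM : 0 < M) (hS : Measurable S) {β : ℝ} (hβ : ∀ θ, P.real (S ⁻¹' arc θ M) ≤ β)
    {m : ℕ} {u : ℝ} (hu : |u| ≤ m / M) :
    ∫ ω, |F (S ω) - F (S ω - u)| ∂P ≤ (2 * m + 1) * V * β := by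
  have hM' : (0 : ℝ) < M := by exact_mod_cast hM
  have hmono : ∀ j : ℕ, 0 ≤ v ((j + 1 + m) / M) - v (((j : ℝ) - m) / M) := by
    intro j
    rw [sub_nonneg]
    apply h.monotone
    gcongr
    have : (0 : ℝ) ≤ m := Nat.cast_nonneg m
    linarith
  have hint : ∀ j ∈ Finset.range M, Integrable (fun ω => (arc (((j : ℝ) + 1 / 2) / M) M).indicator
        (fun _ => v ((j + 1 + m) / M) - v ((j - m) / M)) (S ω)) P := by
    intro j _
    refine Integrable.of_bound (C := |v ((j + 1 + m) / M) - v ((j - m) / M)|) ?_ ?_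
    · exact ((measurable_const.indicator (measurableSet_arc _ _)).comp hS).aestronglyMeasurable
    · refine ae_of_all _ fun ω => ?_
      rw [Real.norm_eq_abs]
      by_cases hm : S ω ∈ arc (((j : ℝ) + 1 / 2) / M) M
      · rw [indicator_of_mem hm]
      · rw [indicator_of_notMem hm]; simp
  calc ∫ ω, |F (S ω) - F (S ω - u)| ∂P
      ≤ ∫ ω, ∑ j ∈ Finset.range M, (arc (((j : ℝ) + 1 / 2) / M) M).indicator
        (fun _ => v ((j + 1 + m) / M) - v ((j - m) / M)) (S ω) ∂P := by
        refine integral_mono ?_ (integrable_finsetSum _ hint)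
          (fun ω => h.abs_sub_shift_le hM hu (S ω))
        refine Integrable.of_bound (C := V) ?_ (ae_of_all _ fun ω => ?_)
        · have := h.measurable
          exact Measurable.aestronglyMeasurable (by fun_prop)
        · rw [Real.norm_eq_abs, abs_abs]
          exact h.abs_sub_le_total _ _
    _ = ∑ j ∈ Finset.range M, P.real (S ⁻¹' arc (((j : ℝ) + 1 / 2) / M) M) *
        (v ((j + 1 + m) / M) - v ((j - m) / M)) := by
        rw [integral_finsetSum _ hint]
        refine Finset.sum_congr rfl fun j _ => ?_
        have : (fun ω => (arc (((j : ℝ) + 1 / 2) / M) M).indicator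
            (fun _ => v ((j + 1 + m) / M) - v ((j - m) / M)) (S ω)) =
            (S ⁻¹' arc (((j : ℝ) + 1 / 2) / M) M).indicator
            (fun _ => v ((j + 1 + m) / M) - v ((j - m) / M)) := rfl
        rw [this, integral_indicator_const _ (hS (measurableSet_arc _ _)), smul_eq_mul]
    _ ≤ ∑ j ∈ Finset.range M, β * (v ((j + 1 + m) / M) - v ((j - m) / M)) := by
        gcongr with j _
        · exact hmono j
        · exact hβ _
    _ = (2 * m + 1) * V * β := by
        rw [← Finset.mul_sum]
        -- Each enlarged cell is a window of `2m + 1` cells starting at `j - m`, so the increments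
        -- add up to `(2m + 1) V`.
        have := sum_range_shift_sub (b := fun j : ℤ => v (j / M)) (M := M) (V := V) (by
          intro j
          rw [← h.add_one]
          congr 1
          push_cast
          field_simp) (-m) (2 * m + 1)
        have e : ∑ j ∈ Finset.range M, (v (((j : ℝ) + 1 + m) / M) - v ((j - m) / M)) =
            ((2 * m + 1 : ℕ) : ℝ) * V := by
          rw [← this]
          refine Finset.sum_congr rfl fun j _ => ?_
          push_cast
          congr 3; ring
        rw [e]
        push_cast
        ring

/-! ### Smoothing and Fourier coefficients -/

/-- Convolution of a periodic function with the kernel `sqKernel p H`. -/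
noncomputable def smooth (p : ℕ → ℝ) (H : ℕ) (F : ℝ → ℝ) (t : ℝ) : ℝ :=
  ∫ u in (-(1 / 2) : ℝ)..(1 / 2), F (t - u) * sqKernel p H u

/-- Fourier coefficients of a function of period one. -/
noncomputable def fourierCoeffUnit (F : ℝ → ℝ) (m : ℤ) : ℂ :=
  ∫ u in (-(1 / 2) : ℝ)..(1 / 2), (F u : ℂ) * expi (-(m * u))

lemma PeriodicVariation.intervalIntegrable_mul (h : PeriodicVariation F v V) {φ : ℝ → ℂ}
    (hφ : Continuous φ) (a b : ℝ) :
    IntervalIntegrable (fun u => (F u : ℂ) * φ u) volume a b :=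
  IntervalIntegrable.mul_continuousOn (f := fun u => (F u : ℂ))
    ⟨(h.intervalIntegrable a b).1.ofReal, (h.intervalIntegrable a b).2.ofReal⟩ hφ.continuousOn

lemma PeriodicVariation.shift (h : PeriodicVariation F v V) (a : ℝ) :
    PeriodicVariation (fun t => F (t - a)) (fun t => v (t - a)) V where
  measurable := by have := h.measurable; fun_prop
  periodic t := by
    have := h.periodic (t - a)
    simp only
    rw [← this]; congr 1; ring
  abs_sub_le s t hst := h.abs_sub_le _ _ (by linarith)
  add_one t := by
    rw [← h.add_one]; congr 1; ring

lemma PeriodicVariation.reflect (h : PeriodicVariation F v V) (a : ℝ) :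
    PeriodicVariation (fun t => F (a - t)) (fun t => - v (a - t)) V where
  measurable := by have := h.measurable; fun_prop
  periodic t := by
    have := h.periodic (a - (t + 1))
    simp only
    rw [← this]; congr 1; ring
  abs_sub_le s t hst := by
    have := h.abs_sub_le (a - t) (a - s) (by linarith)
    rw [abs_sub_comm]
    linarith
  add_one t := by
    have := h.add_one (a - (t + 1))
    rw [show a - (t + 1) + 1 = a - t by ring] at this
    linarith

lemma PeriodicVariation.integral_comp_sub_mul_expi (h : PeriodicVariation F v V) (m : ℤ) (t : ℝ) :
    ∫ u in (-(1 / 2) : ℝ)..(1 / 2), (F (t - u) : ℂ) * expi (m * u) =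
      expi (m * t) * fourierCoeffUnit F m := by
  have h1 : ∀ u : ℝ, (F (t - u) : ℂ) * expi (m * u) =
      (fun x => expi (m * t) * ((F x : ℂ) * expi (-(m * x)))) (t - u) := by
    intro u
    simp only
    have : expi (m * u) = expi (m * t) * expi (-(m * (t - u))) := by
      rw [← expi_add]; congr 1; ring
    rw [this]
    ring
  rw [intervalIntegral.integral_congr fun u _ => h1 u,
    intervalIntegral.integral_comp_sub_left (fun x => expi (m * t) * ((F x : ℂ) * expi (-(m * x)))),
    intervalIntegral.integral_const_mul]
  congr 1
  have per : Function.Periodic (fun x => (F x : ℂ) * expi (-(m * x))) 1 := by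
    intro x
    simp only
    rw [h.periodic x, show -((m : ℝ) * (x + 1)) = -(m * x) + ((-m : ℤ) : ℝ) by push_cast; ring,
      expi_add, expi_intCast, mul_one]
  have := per.intervalIntegral_add_eq (t - 1 / 2) (-(1 / 2))
  rw [show t - 1 / 2 + 1 = t - -(1 / 2) by ring, show -(1 / 2 : ℝ) + 1 = 1 / 2 by ring] at this
  exact this

/-- A shift by the half-period `δ = 1/(2|m|)` flips the sign of the character, so twice the
coefficient is an integral of `F u - F (u - δ)` against it. The increments of `v` dominate this
difference and integrate to `δV`, so no Stieltjes integration by parts is needed. -/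
lemma PeriodicVariation.norm_fourierCoeffUnit_le (h : PeriodicVariation F v V) {m : ℤ}
    (hm : m ≠ 0) : ‖fourierCoeffUnit F m‖ ≤ V / |(m : ℝ)| := by
  have hm' : 0 < |(m : ℝ)| := abs_pos.2 (by exact_mod_cast hm)
  set δ : ℝ := 1 / (2 * |(m : ℝ)|) with hδ
  have hδ0 : 0 < δ := by positivity
  have hexp : expi (m * δ) = -1 := by
    rcases lt_or_gt_of_ne hm with hneg | hpos
    · have : (m : ℝ) < 0 := by exact_mod_cast hneg
      have e : (m : ℝ) * δ = 1 / 2 + ((-1 : ℤ) : ℝ) := by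
        rw [hδ, abs_of_neg this]
        have := this.ne
        field_simp
        push_cast
        ring
      rw [e, expi_add, expi_half, expi_intCast, mul_one]
    · have : (0 : ℝ) < m := by exact_mod_cast hpos
      have e : (m : ℝ) * δ = 1 / 2 := by
        rw [hδ, abs_of_pos this]
        field_simp
      rw [e, expi_half]
  have per : Function.Periodic (fun x => (F x : ℂ) * expi (-(m * x))) 1 := by
    intro x
    simp only
    rw [h.periodic x, show -((m : ℝ) * (x + 1)) = -(m * x) + ((-m : ℤ) : ℝ) by push_cast; ring,
      expi_add, expi_intCast, mul_one]
  have e1 : fourierCoeffUnit F m =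
      -∫ u in (-(1 / 2) : ℝ)..(1 / 2), (F (u - δ) : ℂ) * expi (-(m * u)) := by
    have h1 : ∀ u : ℝ, (F (u - δ) : ℂ) * expi (-(m * u)) =
        -(fun x => (F x : ℂ) * expi (-(m * x))) (u - δ) := by
      intro u
      simp only
      rw [show -((m : ℝ) * (u - δ)) = -(m * u) + m * δ by ring, expi_add, hexp]
      ring
    simp_rw [h1]
    rw [intervalIntegral.integral_neg, neg_neg,
      intervalIntegral.integral_comp_sub_right (fun x => (F x : ℂ) * expi (-(m * x)))]
    have := per.intervalIntegral_add_eq (-(1 / 2)) (-(1 / 2) - δ)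
    unfold fourierCoeffUnit
    convert this using 2 <;> ring
  have e2 : 2 * fourierCoeffUnit F m =
      ∫ u in (-(1 / 2) : ℝ)..(1 / 2), ((F u : ℂ) * expi (-(m * u)) -
        (F (u - δ) : ℂ) * expi (-(m * u))) := by
    rw [intervalIntegral.integral_sub (h.intervalIntegrable_mul (by fun_prop) _ _)
      ((h.shift δ).intervalIntegrable_mul (by fun_prop) _ _), two_mul]
    nth_rewrite 2 [e1]
    rw [← sub_eq_add_neg]
    rfl
  have iv : ∀ a b, IntervalIntegrable v volume a b := fun a b => h.monotone.intervalIntegrable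
  have ivs : ∀ a b, IntervalIntegrable (fun u => v (u - δ)) volume a b := fun a b =>
    (h.shift δ).monotone.intervalIntegrable
  have e3 : ‖2 * fourierCoeffUnit F m‖ ≤
      ∫ u in (-(1 / 2) : ℝ)..(1 / 2), (v u - v (u - δ)) := by
    rw [e2]
    refine intervalIntegral.norm_integral_le_of_norm_le (by norm_num) (ae_of_all _ fun u _ => ?_)
      ((iv _ _).sub (ivs _ _))
    rw [← sub_mul, norm_mul, norm_expi, mul_one, ← Complex.ofReal_sub, Complex.norm_real]
    exact h.abs_sub_le _ _ (by linarith)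
  have e4 : ∫ u in (-(1 / 2) : ℝ)..(1 / 2), (v u - v (u - δ)) = δ * V := by
    rw [intervalIntegral.integral_sub (iv _ _) (ivs _ _),
      intervalIntegral.integral_comp_sub_right (fun x => v x),
      intervalIntegral.integral_interval_sub_interval_comm (iv _ _) (iv _ _) (iv _ _)]
    have : ∫ x in (1 / 2 : ℝ)..(1 / 2 - δ), v x =
        ∫ x in (-(1 / 2) : ℝ)..(-(1 / 2) - δ), v (x + 1) := by
      rw [intervalIntegral.integral_comp_add_right (fun x => v x)]
      congr 1 <;> ring
    rw [this]
    simp_rw [h.add_one]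
    rw [intervalIntegral.integral_add (iv _ _) (by simp), intervalIntegral.integral_const,
      smul_eq_mul]
    ring
  rw [e4, norm_mul] at e3
  simp only [Complex.norm_ofNat] at e3
  have : δ * V ≤ 2 * (V / |(m : ℝ)|) := by
    have hV := h.nonneg
    rw [hδ]
    have : 0 ≤ V / |(m : ℝ)| := by positivity
    calc 1 / (2 * |(m : ℝ)|) * V = V / |(m : ℝ)| / 2 := by field_simp
      _ ≤ _ := by linarith
  linarith

lemma PeriodicVariation.smooth_eq (h : PeriodicVariation F v V) (p : ℕ → ℝ) (H : ℕ) (t : ℝ) :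
    (smooth p H F t : ℂ) = ∑ k ∈ Finset.range (H + 1), ∑ l ∈ Finset.range (H + 1),
      ((p k * p l : ℝ) : ℂ) * (fourierCoeffUnit F ((k : ℤ) - l) *
        expi (((k : ℤ) - (l : ℤ) : ℤ) * t)) := by
  have hi : ∀ m : ℤ, ∀ a : ℂ, IntervalIntegrable (fun u => a * ((F (t - u) : ℂ) * expi (m * u)))
      volume (-(1 / 2)) (1 / 2) := fun m a =>
    ((h.reflect t).intervalIntegrable_mul (φ := fun u => expi (m * u)) (by fun_prop) _ _).const_mul a
  unfold smooth
  rw [← intervalIntegral.integral_ofReal]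
  have : ∀ u : ℝ, ((F (t - u) * sqKernel p H u : ℝ) : ℂ) =
      ∑ k ∈ Finset.range (H + 1), ∑ l ∈ Finset.range (H + 1),
      ((p k * p l : ℝ) : ℂ) * ((F (t - u) : ℂ) * expi (((k : ℤ) - (l : ℤ) : ℤ) * u)) := by
    intro u
    rw [Complex.ofReal_mul, sqKernel_eq, Finset.mul_sum]
    refine Finset.sum_congr rfl fun k _ => ?_
    rw [Finset.mul_sum]
    refine Finset.sum_congr rfl fun l _ => ?_
    ring
  simp_rw [this]
  rw [intervalIntegral.integral_finsetSum]
  · refine Finset.sum_congr rfl fun k _ => ?_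
    rw [intervalIntegral.integral_finsetSum fun l _ => hi _ _]
    refine Finset.sum_congr rfl fun l _ => ?_
    rw [intervalIntegral.integral_const_mul, h.integral_comp_sub_mul_expi, mul_comm (expi _)]
  · intro k _
    have := IntervalIntegrable.sum (Finset.range (H + 1)) fun l _ =>
      hi ((k : ℤ) - l) ((p k * p l : ℝ) : ℂ)
    rwa [show (∑ l ∈ Finset.range (H + 1), fun u : ℝ => ((p k * p l : ℝ) : ℂ) *
      ((F (t - u) : ℂ) * expi (((k : ℤ) - (l : ℤ) : ℤ) * u))) = fun u : ℝ =>
      ∑ l ∈ Finset.range (H + 1), ((p k * p l : ℝ) : ℂ) *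
      ((F (t - u) : ℂ) * expi (((k : ℤ) - (l : ℤ) : ℤ) * u)) from by
        funext u; rw [Finset.sum_apply]] at this

lemma PeriodicVariation.continuous_smooth (h : PeriodicVariation F v V) (p : ℕ → ℝ) (H : ℕ) :
    Continuous (smooth p H F) := by
  have : smooth p H F = fun t => (∑ k ∈ Finset.range (H + 1), ∑ l ∈ Finset.range (H + 1),
      ((p k * p l : ℝ) : ℂ) * (fourierCoeffUnit F ((k : ℤ) - l) *
        expi (((k : ℤ) - (l : ℤ) : ℤ) * t))).re := by
    ext t
    rw [← h.smooth_eq, Complex.ofReal_re]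
  rw [this]
  fun_prop

lemma PeriodicVariation.abs_smooth_le (h : PeriodicVariation F v V)
    (h0 : ∫ u in (-(1 / 2) : ℝ)..(1 / 2), F u = 0) {p : ℕ → ℝ} {H : ℕ}
    (hp : ∫ u in (-(1 / 2) : ℝ)..(1 / 2), sqKernel p H u = 1) (t : ℝ) :
    |smooth p H F t| ≤ V := by
  unfold smooth
  have := intervalIntegral.norm_integral_le_of_norm_le (a := -(1 / 2)) (b := 1 / 2) (μ := volume)
    (f := fun u => F (t - u) * sqKernel p H u)
    (g := fun u => V * sqKernel p H u) (by norm_num) (ae_of_all _ fun u _ => by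
      rw [norm_mul, Real.norm_eq_abs, Real.norm_eq_abs, abs_of_nonneg (sqKernel_nonneg p H u)]
      exact mul_le_mul_of_nonneg_right (h.abs_le_total h0 _) (sqKernel_nonneg p H u))
    ((by fun_prop : Continuous _).intervalIntegrable _ _)
  rw [intervalIntegral.integral_const_mul, hp, mul_one] at this
  exact this

/-- The error is a kernel average of `|F(S) - F(S - u)|`. By Fubini its expectation is a kernel
average of the shift bound, which grows linearly in `H|u|`, and the second moment of the kernel
absorbs this growth. -/
lemma PeriodicVariation.integral_abs_sub_smooth_le (h : PeriodicVariation F v V) {p : ℕ → ℝ}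
    {H : ℕ} (hH : 1 ≤ H)
    (hp : ∫ u in (-(1 / 2) : ℝ)..(1 / 2), sqKernel p H u = 1)
    (hp2 : ∫ u in (-(1 / 2) : ℝ)..(1 / 2), sqKernel p H u * (5 + 2 * (H : ℝ) ^ 2 * u ^ 2) ≤ 7)
    (hS : Measurable S) {β : ℝ} (hβ : ∀ θ, P.real (S ⁻¹' arc θ (2 * H)) ≤ β) :
    ∫ ω, |F (S ω) - smooth p H F (S ω)| ∂P ≤ 7 * V * β := by
  have hF := h.measurable
  have hV := h.nonneg
  have hβ0 : 0 ≤ β := le_trans measureReal_nonneg (hβ 0)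
  have hHr : (1 : ℝ) ≤ H := by exact_mod_cast hH
  set J := sqKernel p H with hJdef
  have hJ : Continuous J := continuous_sqKernel p H
  have hJm : Measurable J := hJ.measurable
  have hJ0 : ∀ u, 0 ≤ J u := sqKernel_nonneg p H
  set τ : Measure ℝ := volume.restrict (Ioc (-(1 / 2)) (1 / 2)) with hτ
  have hpt : ∀ t, |F t - smooth p H F t| ≤ ∫ u, |F t - F (t - u)| * J u ∂τ := by
    intro t
    have e : F t - smooth p H F t = ∫ u in (-(1 / 2) : ℝ)..(1 / 2), (F t - F (t - u)) * J u := by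
      unfold smooth
      simp_rw [sub_mul]
      rw [intervalIntegral.integral_sub, intervalIntegral.integral_const_mul, hp, mul_one]
      · exact (by fun_prop : Continuous _).intervalIntegrable _ _
      · exact ((h.reflect t).intervalIntegrable _ _).mul_continuousOn hJ.continuousOn
    rw [e, intervalIntegral.integral_of_le (by norm_num)]
    refine (abs_integral_le_integral_abs).trans (le_of_eq ?_)
    refine integral_congr_ae (ae_of_all _ fun u => ?_)
    simp only
    rw [abs_mul, abs_of_nonneg (hJ0 u)]
  have hJint : Integrable J τ := by
    rw [hτ, ← IntegrableOn, ← intervalIntegrable_iff_integrableOn_Ioc_of_le (by norm_num)]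
    exact hJ.intervalIntegrable _ _
  have hprod : Integrable (fun z : Ω × ℝ => |F (S z.1) - F (S z.1 - z.2)| * J z.2) (P.prod τ) := by
    refine Integrable.mono' (g := fun z => V * J z.2) ?_ ?_ (ae_of_all _ fun z => ?_)
    · exact (hJint.comp_snd P).const_mul V
    · exact Measurable.aestronglyMeasurable (by fun_prop)
    · rw [Real.norm_eq_abs, abs_mul, abs_abs, abs_of_nonneg (hJ0 _)]
      exact mul_le_mul_of_nonneg_right (h.abs_sub_le_total _ _) (hJ0 _)
  have hbound : ∀ u, ∫ ω, |F (S ω) - F (S ω - u)| * J u ∂P ≤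
      V * β * (J u * (5 + 2 * (H : ℝ) ^ 2 * u ^ 2)) := by
    intro u
    rw [integral_mul_const]
    have h1 := h.integral_abs_sub_shift_le (M := 2 * H) (by omega) hS hβ
      (m := ⌈2 * (H : ℝ) * |u|⌉₊) (u := u) (by
        rw [le_div_iff₀ (by push_cast; positivity)]
        push_cast
        linarith [Nat.le_ceil (2 * (H : ℝ) * |u|)])
    have h2 : (⌈2 * (H : ℝ) * |u|⌉₊ : ℝ) < 2 * H * |u| + 1 := Nat.ceil_lt_add_one (by positivity)
    -- The left side is at most `3 + 4H|u|`, and `4H|u| ≤ 2 + 2H²u²`. The weight in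
    -- `exists_jackson_coeff` has this form for this reason.
    have h3 : 2 * (⌈2 * (H : ℝ) * |u|⌉₊ : ℝ) + 1 ≤ 5 + 2 * (H : ℝ) ^ 2 * u ^ 2 := by
      have := sq_nonneg ((H : ℝ) * |u| - 1)
      have e : ((H : ℝ) * |u|) ^ 2 = (H : ℝ) ^ 2 * u ^ 2 := by rw [mul_pow, sq_abs]
      nlinarith
    calc (∫ ω, |F (S ω) - F (S ω - u)| ∂P) * J u
        ≤ ((2 * (⌈2 * (H : ℝ) * |u|⌉₊ : ℝ) + 1) * V * β) * J u :=
          mul_le_mul_of_nonneg_right h1 (hJ0 u)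
      _ ≤ ((5 + 2 * (H : ℝ) ^ 2 * u ^ 2) * V * β) * J u := by
          have := hJ0 u
          gcongr
      _ = _ := by ring
  calc ∫ ω, |F (S ω) - smooth p H F (S ω)| ∂P
      ≤ ∫ ω, ∫ u, |F (S ω) - F (S ω - u)| * J u ∂τ ∂P := by
        refine integral_mono_of_nonneg (ae_of_all _ fun _ => abs_nonneg _)
          hprod.integral_prod_left (ae_of_all _ fun ω => hpt _)
    _ = ∫ u, ∫ ω, |F (S ω) - F (S ω - u)| * J u ∂P ∂τ := integral_integral_swap hprod
    _ ≤ ∫ u, V * β * (J u * (5 + 2 * (H : ℝ) ^ 2 * u ^ 2)) ∂τ := by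
        refine integral_mono hprod.integral_prod_right ?_ hbound
        rw [hτ, ← IntegrableOn, ← intervalIntegrable_iff_integrableOn_Ioc_of_le (by norm_num)]
        exact (by fun_prop : Continuous _).intervalIntegrable _ _
    _ = V * β * ∫ u in (-(1 / 2) : ℝ)..(1 / 2), J u * (5 + 2 * (H : ℝ) ^ 2 * u ^ 2) := by
        rw [integral_const_mul, intervalIntegral.integral_of_le (by norm_num)]
    _ ≤ V * β * 7 := by gcongr
    _ = 7 * V * β := by ring

/-! ### Probabilities of short arcs -/

/-- Factoring out the middle frequency `H/2` leaves phases of size at most `2π · (H/2) · 1/(4H) =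
π/4`. Every term then has real part at least `cos (π/4)`, and no cancellation occurs. -/
lemma sqKernel_one_ge_of_mem_arc {H : ℕ} (hH : 1 ≤ H) {θ t : ℝ} (ht : t ∈ arc θ (2 * H)) :
    ((H : ℝ) + 1) ^ 2 / 2 ≤ sqKernel (fun _ => 1) H (t - θ) := by
  obtain ⟨n, hn⟩ := ht
  have hHr : (1 : ℝ) ≤ H := by exact_mod_cast hH
  set δ := t - θ - n with hδ
  have e1 : ∀ k : ℕ, expi (k * (t - θ)) = expi (H / 2 * δ) * expi ((k - H / 2) * δ) := by
    intro k
    rw [← expi_add, show (k : ℝ) * (t - θ) =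
      (H / 2 * δ + (k - H / 2) * δ) + ((k * n : ℤ) : ℝ) by rw [hδ]; push_cast; ring, expi_add,
      expi_intCast, mul_one]
  have e2 : ∀ k ∈ Finset.range (H + 1), Real.cos (Real.pi / 4) ≤ (expi ((k - H / 2) * δ)).re := by
    intro k hk
    have hk' : (k : ℝ) ≤ H := by exact_mod_cast Nat.lt_succ_iff.1 (Finset.mem_range.1 hk)
    have hk0 : (0 : ℝ) ≤ k := Nat.cast_nonneg k
    rw [re_expi, ← Real.cos_abs (2 * Real.pi * _)]
    have hb : |2 * Real.pi * ((k - H / 2) * δ)| ≤ Real.pi / 4 := by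
      rw [abs_mul, abs_of_pos (by positivity : (0 : ℝ) < 2 * Real.pi), abs_mul]
      have a1 : |(k : ℝ) - H / 2| ≤ H / 2 := by rw [abs_le]; constructor <;> linarith
      have a2 : |(k : ℝ) - H / 2| * |δ| ≤ H / 2 * (1 / (2 * ((2 * H : ℕ) : ℝ))) :=
        mul_le_mul a1 hn (abs_nonneg _) (by positivity)
      have a3 : (H : ℝ) / 2 * (1 / (2 * ((2 * H : ℕ) : ℝ))) = 1 / 8 := by
        push_cast; field_simp; norm_num
      rw [a3] at a2
      nlinarith [Real.pi_pos]
    exact Real.cos_le_cos_of_nonneg_of_le_pi (abs_nonneg _) (by linarith [Real.pi_pos]) hb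
  have e3 : ((H : ℝ) + 1) * Real.cos (Real.pi / 4) ≤
      ‖∑ k ∈ Finset.range (H + 1), ((1 : ℝ) : ℂ) * expi (k * (t - θ))‖ := by
    simp_rw [e1, Complex.ofReal_one, one_mul]
    rw [← Finset.mul_sum, norm_mul, norm_expi, one_mul]
    refine le_trans ?_ (Complex.re_le_norm _)
    rw [Complex.re_sum]
    have := Finset.card_nsmul_le_sum _ _ _ e2
    simpa using this
  unfold sqKernel
  have e4 : (((H : ℝ) + 1) * Real.cos (Real.pi / 4)) ^ 2 = ((H : ℝ) + 1) ^ 2 / 2 := by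
    rw [Real.cos_pi_div_four, mul_pow, div_pow, Real.sq_sqrt (by norm_num)]
    ring
  rw [← e4]
  refine pow_le_pow_left₀ ?_ e3 2
  rw [Real.cos_pi_div_four]
  positivity

lemma integrable_expi_comp {Y : Ω → ℝ} (hY : Measurable Y) : Integrable (fun ω => expi (Y ω)) P :=
  Integrable.of_bound (C := 1) (measurable_expi.comp hY).aestronglyMeasurable (by simp)

/-- The unnormalised Fejér kernel is at least `(H+1)²/2` on the arc, while its mean is at most `H +
1` times the sum of the Fourier coefficients. The centre `θ` only rotates these coefficients. -/
lemma measureReal_arc_le {H : ℕ} (hH : 1 ≤ H) (hS : Measurable S) (θ : ℝ) :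
    P.real (S ⁻¹' arc θ (2 * H)) ≤
      2 / ((H : ℝ) + 1) * ∑ m ∈ Finset.Icc (-(H : ℤ)) H, ‖∫ ω, expi (m * S ω) ∂P‖ := by
  set K := fun ω => sqKernel (fun _ => 1) H (S ω - θ) with hK
  have hKb : ∀ ω, ‖K ω‖ ≤ ((H : ℝ) + 1) ^ 2 := by
    intro ω
    simp only [hK, sqKernel]
    rw [norm_pow, norm_norm]
    gcongr
    refine (norm_sum_le _ _).trans ?_
    simp
  have hKm : Measurable K :=
    (continuous_sqKernel _ _).measurable.comp (hS.sub_const θ)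
  have hKi : Integrable K P := Integrable.of_bound hKm.aestronglyMeasurable _ (ae_of_all _ hKb)
  have hmeas : MeasurableSet (S ⁻¹' arc θ (2 * H)) := hS (measurableSet_arc _ _)
  have h1 : P.real (S ⁻¹' arc θ (2 * H)) * (((H : ℝ) + 1) ^ 2 / 2) ≤ ∫ ω, K ω ∂P := by
    rw [← smul_eq_mul, ← integral_indicator_const _ hmeas]
    refine integral_mono ((integrable_const _).indicator hmeas) hKi fun ω => ?_
    by_cases hω : ω ∈ S ⁻¹' arc θ (2 * H)
    · rw [indicator_of_mem hω]
      exact sqKernel_one_ge_of_mem_arc hH hω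
    · rw [indicator_of_notMem hω]
      exact sqKernel_nonneg _ _ _
  have h2 : ∫ ω, K ω ∂P ≤
      ((H : ℝ) + 1) * ∑ m ∈ Finset.Icc (-(H : ℤ)) H, ‖∫ ω, expi (m * S ω) ∂P‖ := by
    have i1 : ∀ m : ℤ, Integrable (fun ω => expi (m * (S ω - θ))) P := fun m =>
      integrable_expi_comp (by fun_prop)
    have e : ((∫ ω, K ω ∂P : ℝ) : ℂ) = ∑ k ∈ Finset.range (H + 1), ∑ l ∈ Finset.range (H + 1),
        ∫ ω, expi (((k : ℤ) - (l : ℤ) : ℤ) * (S ω - θ)) ∂P := by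
      rw [← integral_complex_ofReal]
      simp only [hK, sqKernel_eq, mul_one, Complex.ofReal_one, one_mul]
      rw [integral_finsetSum _ fun k _ => integrable_finsetSum _ fun l _ => i1 _]
      refine Finset.sum_congr rfl fun k _ => ?_
      rw [integral_finsetSum _ fun l _ => i1 _]
    have hn : ∀ m : ℤ, ‖∫ ω, expi (m * (S ω - θ)) ∂P‖ = ‖∫ ω, expi (m * S ω) ∂P‖ := by
      intro m
      have : ∀ ω, expi (m * (S ω - θ)) = expi (-(m * θ)) * expi (m * S ω) := by
        intro ω
        rw [← expi_add]; congr 1; ring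
      simp_rw [this]
      rw [integral_const_mul, norm_mul, norm_expi, one_mul]
    calc ∫ ω, K ω ∂P ≤ ‖((∫ ω, K ω ∂P : ℝ) : ℂ)‖ := by
          rw [Complex.norm_real]; exact le_abs_self _
      _ ≤ ∑ k ∈ Finset.range (H + 1), ∑ l ∈ Finset.range (H + 1),
          |(1 : ℝ) * 1| * ‖∫ ω, expi (((k : ℤ) - (l : ℤ) : ℤ) * S ω) ∂P‖ := by
          rw [e]
          refine (norm_sum_le _ _).trans (Finset.sum_le_sum fun k _ => ?_)
          refine (norm_sum_le _ _).trans (Finset.sum_le_sum fun l _ => ?_)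
          rw [hn]
          simp
      _ ≤ _ := by
          have := sum_sum_mul_le_sum_Icc (fun _ => 1) H
            (fun m => ‖∫ ω, expi (m * S ω) ∂P‖) (fun _ => norm_nonneg _)
          simpa using this
  have hHp : (0 : ℝ) < (H : ℝ) + 1 := by positivity
  have h3 := h1.trans h2
  have : P.real (S ⁻¹' arc θ (2 * H)) * ((H : ℝ) + 1) ≤
      2 * ∑ m ∈ Finset.Icc (-(H : ℤ)) H, ‖∫ ω, expi (m * S ω) ∂P‖ := by
    nlinarith
  rw [div_mul_eq_mul_div, le_div_iff₀ hHp]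
  exact this

end Shift

/-! ### The Erdős–Turán–Koksma bound for two phases -/

/-- The weighted sum of the Fourier coefficients of the joint law of `S` and `T`. -/
noncomputable def coeffSum {Ω : Type*} [MeasurableSpace Ω] (P : Measure Ω) (S T : Ω → ℝ) (H : ℕ) : ℝ :=
  ∑ ab ∈ nonzeroPairs H, ‖∫ ω, expi (ab.1 * S ω + ab.2 * T ω) ∂P‖ /
    (max |(ab.1 : ℝ)| 1 * max |(ab.2 : ℝ)| 1)

lemma coeffSum_comm {Ω : Type*} [MeasurableSpace Ω] (P : Measure Ω) (S T : Ω → ℝ) (H : ℕ) : coeffSum P S T H = coeffSum P T S H := by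
  unfold coeffSum
  refine Finset.sum_bij' (fun ab _ => ab.swap) (fun ab _ => ab.swap) ?_ ?_ ?_ ?_ ?_
  · rintro ⟨a, b⟩ h
    simp only [nonzeroPairs, Finset.mem_erase, Finset.mem_product, ne_eq, Prod.mk.injEq,
      Prod.swap_prod_mk] at h ⊢
    tauto
  · rintro ⟨a, b⟩ h
    simp only [nonzeroPairs, Finset.mem_erase, Finset.mem_product, ne_eq, Prod.mk.injEq,
      Prod.swap_prod_mk] at h ⊢
    tauto
  · simp
  · simp
  · rintro ⟨a, b⟩ _
    simp only [Prod.swap_prod_mk]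
    simp_rw [add_comm]
    rw [mul_comm (max _ _)]

section Pair

variable {Ω : Type*} [MeasurableSpace Ω] {P : Measure Ω} [IsProbabilityMeasure P] {S T : Ω → ℝ}
  {F G v w : ℝ → ℝ} {V W : ℝ}

lemma fourierCoeffUnit_zero_of_mean_zero (h0 : ∫ u in (-(1 / 2) : ℝ)..(1 / 2), F u = 0) :
    fourierCoeffUnit F 0 = 0 := by
  unfold fourierCoeffUnit
  simp only [Int.cast_zero, zero_mul, neg_zero, expi_zero, mul_one]
  rw [intervalIntegral.integral_ofReal, h0, Complex.ofReal_zero]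

lemma PeriodicVariation.norm_fourierCoeffUnit_le_max (h : PeriodicVariation F v V)
    (h0 : ∫ u in (-(1 / 2) : ℝ)..(1 / 2), F u = 0) (m : ℤ) :
    ‖fourierCoeffUnit F m‖ ≤ V / max |(m : ℝ)| 1 := by
  by_cases hm : m = 0
  · subst hm
    rw [fourierCoeffUnit_zero_of_mean_zero h0, norm_zero]
    have := h.nonneg
    positivity
  · have : (1 : ℝ) ≤ |(m : ℝ)| := by exact_mod_cast Int.one_le_abs hm
    rw [max_eq_left this]
    exact h.norm_fourierCoeffUnit_le hm

/-- The zero frequency gives the term `1/H`. The others are the pairs `(m, 0)` of `coeffSum`, whose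
weights `1/|m|` exceed the available `1/(H+1)`. -/
lemma measureReal_arc_le_coeffSum {H : ℕ} (hH : 1 ≤ H) (hS : Measurable S) (θ : ℝ) :
    P.real (S ⁻¹' arc θ (2 * H)) ≤ 2 * (1 / H + coeffSum P S T H) := by
  refine (measureReal_arc_le hH hS θ).trans ?_
  have hHr : (1 : ℝ) ≤ H := by exact_mod_cast hH
  set e : ℤ → ℝ := fun m => ‖∫ ω, expi (m * S ω) ∂P‖ with he
  have h0 : (0 : ℤ) ∈ Finset.Icc (-(H : ℤ)) H := by simp
  have e0 : e 0 = 1 := by simp [he]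
  rw [← Finset.add_sum_erase _ _ h0]
  change 2 / ((H : ℝ) + 1) * (e 0 + ∑ m ∈ (Finset.Icc (-(H : ℤ)) H).erase 0, e m) ≤ _
  have hsum : (1 / ((H : ℝ) + 1)) * ∑ m ∈ (Finset.Icc (-(H : ℤ)) H).erase 0, e m ≤
      coeffSum P S T H := by
    rw [Finset.mul_sum]
    calc ∑ m ∈ (Finset.Icc (-(H : ℤ)) H).erase 0, 1 / ((H : ℝ) + 1) * e m
        ≤ ∑ m ∈ (Finset.Icc (-(H : ℤ)) H).erase 0, e m / max |(m : ℝ)| 1 := by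
          refine Finset.sum_le_sum fun m hm => ?_
          rw [one_div, mul_comm, ← div_eq_mul_inv]
          refine div_le_div_of_nonneg_left (norm_nonneg _) (by positivity) ?_
          have hm' := Finset.mem_Icc.1 (Finset.mem_of_mem_erase hm)
          have : |m| ≤ (H : ℤ) := abs_le.2 hm'
          have : |(m : ℝ)| ≤ H := by exact_mod_cast this
          exact max_le (by linarith) (by linarith)
      _ = ∑ ab ∈ ((Finset.Icc (-(H : ℤ)) H).erase 0).image fun m => (m, (0 : ℤ)), ‖∫ ω, expi (ab.1 * S ω + ab.2 * T ω) ∂P‖ /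
            (max |(ab.1 : ℝ)| 1 * max |(ab.2 : ℝ)| 1) := by
          rw [Finset.sum_image fun a _ b _ h => by simpa using h]
          refine Finset.sum_congr rfl fun m _ => ?_
          simp [he]
      _ ≤ coeffSum P S T H := by
          refine Finset.sum_le_sum_of_subset_of_nonneg ?_ fun _ _ _ => by positivity
          intro ab hab
          obtain ⟨m, hm, rfl⟩ := Finset.mem_image.1 hab
          simp only [Finset.mem_erase, nonzeroPairs, Finset.mem_product, Prod.mk.injEq, and_true, ne_eq] at hm ⊢
          exact ⟨hm.1, hm.2, h0⟩
  have h1 : 1 / ((H : ℝ) + 1) ≤ 1 / H := by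
    apply one_div_le_one_div_of_le <;> linarith
  rw [e0]
  calc 2 / ((H : ℝ) + 1) * (1 + ∑ m ∈ (Finset.Icc (-(H : ℤ)) H).erase 0, e m)
      = 2 * (1 / ((H : ℝ) + 1) +
        1 / ((H : ℝ) + 1) * ∑ m ∈ (Finset.Icc (-(H : ℤ)) H).erase 0, e m) := by ring
    _ ≤ _ := by gcongr

/-- Both factors are trigonometric polynomials, so the expectation is a finite sum of joint Fourier
coefficients. Schur's test is applied to each factor in turn, and then the decay `V/|m|` is
inserted. -/
lemma norm_integral_smooth_mul_smooth_le (hF : PeriodicVariation F v V)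
    (hG : PeriodicVariation G w W) (hF0 : ∫ u in (-(1 / 2) : ℝ)..(1 / 2), F u = 0)
    (hG0 : ∫ u in (-(1 / 2) : ℝ)..(1 / 2), G u = 0) (hS : Measurable S) (hT : Measurable T)
    {H : ℕ} {p : ℕ → ℝ} (hp : ∑ k ∈ Finset.range (H + 1), p k ^ 2 = 1) :
    |∫ ω, smooth p H F (S ω) * smooth p H G (T ω) ∂P| ≤ V * W * coeffSum P S T H := by
  set E : ℤ → ℤ → ℝ := fun a b => ‖∫ ω, expi (a * S ω + b * T ω) ∂P‖ with hE
  set f : ℤ → ℂ := fourierCoeffUnit F with hf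
  set g : ℤ → ℂ := fourierCoeffUnit G with hg
  have hV := hF.nonneg
  have hW := hG.nonneg
  have hi : ∀ c : ℂ, ∀ a b : ℤ, Integrable (fun ω => c * expi (a * S ω + b * T ω)) P :=
    fun c a b => (integrable_expi_comp (by fun_prop)).const_mul c
  have e1 : ((∫ ω, smooth p H F (S ω) * smooth p H G (T ω) ∂P : ℝ) : ℂ) =
      ∑ k ∈ Finset.range (H + 1), ∑ l ∈ Finset.range (H + 1),
      ∑ k' ∈ Finset.range (H + 1), ∑ l' ∈ Finset.range (H + 1),
        (((p k * p l : ℝ) : ℂ) * f ((k : ℤ) - l) * (((p k' * p l' : ℝ) : ℂ) * g ((k' : ℤ) - l'))) *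
        ∫ ω, expi (((k : ℤ) - l : ℤ) * S ω + ((k' : ℤ) - l' : ℤ) * T ω) ∂P := by
    rw [← integral_complex_ofReal]
    have : ∀ ω, ((smooth p H F (S ω) * smooth p H G (T ω) : ℝ) : ℂ) =
      ∑ k ∈ Finset.range (H + 1), ∑ l ∈ Finset.range (H + 1),
      ∑ k' ∈ Finset.range (H + 1), ∑ l' ∈ Finset.range (H + 1),
        (((p k * p l : ℝ) : ℂ) * f ((k : ℤ) - l) * (((p k' * p l' : ℝ) : ℂ) * g ((k' : ℤ) - l'))) *
        expi (((k : ℤ) - l : ℤ) * S ω + ((k' : ℤ) - l' : ℤ) * T ω) := by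
      intro ω
      rw [Complex.ofReal_mul, hF.smooth_eq, hG.smooth_eq, Finset.sum_mul]
      refine Finset.sum_congr rfl fun k _ => ?_
      rw [Finset.sum_mul]
      refine Finset.sum_congr rfl fun l _ => ?_
      rw [Finset.mul_sum]
      refine Finset.sum_congr rfl fun k' _ => ?_
      rw [Finset.mul_sum]
      refine Finset.sum_congr rfl fun l' _ => ?_
      rw [expi_add]
      ring
    simp_rw [this]
    rw [integral_finsetSum _ fun k _ => integrable_finsetSum _ fun l _ =>
      integrable_finsetSum _ fun k' _ => integrable_finsetSum _ fun l' _ => hi _ _ _]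
    refine Finset.sum_congr rfl fun k _ => ?_
    rw [integral_finsetSum _ fun l _ =>
      integrable_finsetSum _ fun k' _ => integrable_finsetSum _ fun l' _ => hi _ _ _]
    refine Finset.sum_congr rfl fun l _ => ?_
    rw [integral_finsetSum _ fun k' _ => integrable_finsetSum _ fun l' _ => hi _ _ _]
    refine Finset.sum_congr rfl fun k' _ => ?_
    rw [integral_finsetSum _ fun l' _ => hi _ _ _]
    refine Finset.sum_congr rfl fun l' _ => ?_
    rw [integral_const_mul]
  have inner : ∀ a : ℤ, ∑ k ∈ Finset.range (H + 1), ∑ l ∈ Finset.range (H + 1),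
      |p k * p l| * (‖g ((k : ℤ) - l)‖ * E a ((k : ℤ) - l)) ≤
      ∑ b ∈ Finset.Icc (-(H : ℤ)) H, ‖g b‖ * E a b := by
    intro a
    have := sum_sum_mul_le_sum_Icc p H (fun b => ‖g b‖ * E a b) (fun b => by positivity)
    rwa [hp, one_mul] at this
  have outer := sum_sum_mul_le_sum_Icc p H
    (fun a => ‖f a‖ * ∑ b ∈ Finset.Icc (-(H : ℤ)) H, ‖g b‖ * E a b)
    (fun a => mul_nonneg (norm_nonneg _) (Finset.sum_nonneg fun b _ => by positivity))
  rw [hp, one_mul] at outer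
  have bound : |∫ ω, smooth p H F (S ω) * smooth p H G (T ω) ∂P| ≤
      ∑ a ∈ Finset.Icc (-(H : ℤ)) H, ‖f a‖ * ∑ b ∈ Finset.Icc (-(H : ℤ)) H, ‖g b‖ * E a b := by
    refine le_trans ?_ outer
    rw [← Real.norm_eq_abs, ← Complex.norm_real, e1]
    refine (norm_sum_le _ _).trans (Finset.sum_le_sum fun k _ => ?_)
    refine (norm_sum_le _ _).trans (Finset.sum_le_sum fun l _ => ?_)
    refine le_trans ?_ (mul_le_mul_of_nonneg_left (mul_le_mul_of_nonneg_left
      (inner ((k : ℤ) - l)) (norm_nonneg _)) (abs_nonneg _))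
    rw [Finset.mul_sum, Finset.mul_sum]
    refine (norm_sum_le _ _).trans (Finset.sum_le_sum fun k' _ => ?_)
    rw [Finset.mul_sum, Finset.mul_sum]
    refine (norm_sum_le _ _).trans (Finset.sum_le_sum fun l' _ => le_of_eq ?_)
    simp only [norm_mul, Complex.norm_real, Real.norm_eq_abs, hE, abs_mul]
    ring
  refine bound.trans ?_
  simp_rw [Finset.mul_sum]
  rw [← Finset.sum_product' (f := fun a b => ‖f a‖ * (‖g b‖ * E a b)),
    ← Finset.add_sum_erase _ _ (show ((0 : ℤ), (0 : ℤ)) ∈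
      Finset.Icc (-(H : ℤ)) H ×ˢ Finset.Icc (-(H : ℤ)) H by simp)]
  -- The mean-zero condition removes the pair `(0, 0)`, whose character has expectation one whatever
  -- the law of the phases.
  rw [hf, fourierCoeffUnit_zero_of_mean_zero hF0, norm_zero, zero_mul, zero_add, coeffSum,
    Finset.mul_sum]
  refine Finset.sum_le_sum fun ab _ => ?_
  calc ‖fourierCoeffUnit F ab.1‖ * (‖g ab.2‖ * E ab.1 ab.2)
      ≤ V / max |(ab.1 : ℝ)| 1 * (W / max |(ab.2 : ℝ)| 1 * E ab.1 ab.2) := by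
        gcongr
        · exact hF.norm_fourierCoeffUnit_le_max hF0 _
        · exact hG.norm_fourierCoeffUnit_le_max hG0 _
    _ = _ := by
        simp only [hE]
        field_simp

/-- An inequality of Erdős–Turán–Koksma type for products of periodic functions of bounded
variation. -/
lemma abs_integral_mul_le_coeffSum (hF : PeriodicVariation F v V)
    (hG : PeriodicVariation G w W) (hF0 : ∫ u in (-(1 / 2) : ℝ)..(1 / 2), F u = 0)
    (hG0 : ∫ u in (-(1 / 2) : ℝ)..(1 / 2), G u = 0) (hS : Measurable S) (hT : Measurable T)
    {H : ℕ} (hH : 1 ≤ H) :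
    |∫ ω, F (S ω) * G (T ω) ∂P| ≤ 29 * V * W * (1 / H + coeffSum P S T H) := by
  obtain ⟨p, hp1, hp2, hp3⟩ := exists_jackson_coeff hH
  set Q := 1 / (H : ℝ) + coeffSum P S T H with hQ
  have hV := hF.nonneg
  have hW := hG.nonneg
  have hFm := hF.measurable
  have hGm := hG.measurable
  have hFs := (hF.continuous_smooth p H).measurable
  have hGs := (hG.continuous_smooth p H).measurable
  have hSarc : ∀ θ, P.real (S ⁻¹' arc θ (2 * H)) ≤ 2 * Q :=
    fun θ => measureReal_arc_le_coeffSum hH hS θ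
  have hTarc : ∀ θ, P.real (T ⁻¹' arc θ (2 * H)) ≤ 2 * Q := by
    intro θ
    rw [hQ, coeffSum_comm]
    exact measureReal_arc_le_coeffSum hH hT θ
  have eF := hF.integral_abs_sub_smooth_le hH hp2 hp3 hS hSarc
  have eG := hG.integral_abs_sub_smooth_le hH hp2 hp3 hT hTarc
  have bF := hF.abs_le_total hF0
  have bG := hG.abs_le_total hG0
  have bFs := hF.abs_smooth_le hF0 hp2
  have bGs := hG.abs_smooth_le hG0 hp2
  have iF : Integrable (fun ω => |F (S ω) - smooth p H F (S ω)|) P := by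
    refine Integrable.of_bound (Measurable.aestronglyMeasurable (by fun_prop)) (V + V)
      (ae_of_all _ fun ω => ?_)
    rw [Real.norm_eq_abs, abs_abs]
    exact (abs_sub _ _).trans (add_le_add (bF _) (bFs _))
  have iG : Integrable (fun ω => |G (T ω) - smooth p H G (T ω)|) P := by
    refine Integrable.of_bound (Measurable.aestronglyMeasurable (by fun_prop)) (W + W)
      (ae_of_all _ fun ω => ?_)
    rw [Real.norm_eq_abs, abs_abs]
    exact (abs_sub _ _).trans (add_le_add (bG _) (bGs _))
  have i1 : Integrable (fun ω => F (S ω) * G (T ω)) P := by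
    refine Integrable.of_bound (Measurable.aestronglyMeasurable (by fun_prop)) (V * W)
      (ae_of_all _ fun ω => ?_)
    rw [Real.norm_eq_abs, abs_mul]
    exact mul_le_mul (bF _) (bG _) (abs_nonneg _) hV
  have i2 : Integrable (fun ω => smooth p H F (S ω) * smooth p H G (T ω)) P := by
    refine Integrable.of_bound (Measurable.aestronglyMeasurable (by fun_prop)) (V * W)
      (ae_of_all _ fun ω => ?_)
    rw [Real.norm_eq_abs, abs_mul]
    exact mul_le_mul (bFs _) (bGs _) (abs_nonneg _) hV
  have main := norm_integral_smooth_mul_smooth_le (P := P) hF hG hF0 hG0 hS hT hp1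
  have err : |∫ ω, F (S ω) * G (T ω) ∂P - ∫ ω, smooth p H F (S ω) * smooth p H G (T ω) ∂P| ≤
      W * (7 * V * (2 * Q)) + V * (7 * W * (2 * Q)) := by
    rw [← integral_sub i1 i2]
    refine (abs_integral_le_integral_abs).trans ?_
    calc ∫ ω, |F (S ω) * G (T ω) - smooth p H F (S ω) * smooth p H G (T ω)| ∂P
        ≤ ∫ ω, (W * |F (S ω) - smooth p H F (S ω)| + V * |G (T ω) - smooth p H G (T ω)|) ∂P := by
          refine integral_mono (i1.sub i2).abs ((iF.const_mul W).add (iG.const_mul V)) fun ω => ?_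
          have : F (S ω) * G (T ω) - smooth p H F (S ω) * smooth p H G (T ω) =
            G (T ω) * (F (S ω) - smooth p H F (S ω)) +
              smooth p H F (S ω) * (G (T ω) - smooth p H G (T ω)) := by ring
          simp only
          rw [this]
          refine (abs_add_le _ _).trans ?_
          rw [abs_mul, abs_mul]
          gcongr
          · exact bG _
          · exact bFs _
      _ = W * ∫ ω, |F (S ω) - smooth p H F (S ω)| ∂P +
          V * ∫ ω, |G (T ω) - smooth p H G (T ω)| ∂P := by
          rw [integral_add (iF.const_mul W) (iG.const_mul V), integral_const_mul,
            integral_const_mul]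
      _ ≤ _ := by gcongr
  have hQ' : coeffSum P S T H ≤ Q := by
    rw [hQ]
    have : (0 : ℝ) ≤ 1 / H := by positivity
    linarith
  have h3 : V * W * coeffSum P S T H ≤ V * W * Q := by gcongr
  -- Two smoothing errors of `14VWQ` each and a main term of at most `VWQ` give the constant `29`.
  have := abs_sub_abs_le_abs_sub (∫ ω, F (S ω) * G (T ω) ∂P)
    (∫ ω, smooth p H F (S ω) * smooth p H G (T ω) ∂P)
  linarith

end Pair

/-! ### Logarithmic and Gaussian weights -/

lemma sum_Icc_one_div_max (H : ℕ) :
    ∑ m ∈ Finset.Icc (-(H : ℤ)) H, 1 / max |(m : ℝ)| 1 = 1 + 2 * (harmonic H : ℝ) := by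
  induction H with
  | zero => simp
  | succ H ih =>
    have e : Finset.Icc (-((H + 1 : ℕ) : ℤ)) ((H + 1 : ℕ) : ℤ) =
        insert (-((H + 1 : ℕ) : ℤ)) (insert ((H + 1 : ℕ) : ℤ) (Finset.Icc (-(H : ℤ)) H)) := by
      ext m
      simp only [Finset.mem_Icc, Finset.mem_insert]
      omega
    have hm : max |(H : ℝ) + 1| 1 = H + 1 := by
      have : (0 : ℝ) ≤ H := Nat.cast_nonneg H
      rw [abs_of_nonneg (by positivity), max_eq_left (by linarith)]
    rw [e, Finset.sum_insert, Finset.sum_insert, ih, harmonic_succ]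
    · push_cast
      rw [abs_neg, hm]
      ring
    · simp
    · simp only [Finset.mem_insert, Finset.mem_Icc]
      omega

lemma sum_Icc_one_div_max_le {H : ℕ} (hH : 1 ≤ H) :
    ∑ m ∈ Finset.Icc (-(H : ℤ)) H, 1 / max |(m : ℝ)| 1 ≤ 8 * Real.log (H + 1) := by
  rw [sum_Icc_one_div_max]
  have hHr : (1 : ℝ) ≤ H := by exact_mod_cast hH
  have h1 := harmonic_le_one_add_log H
  have h2 : Real.log H ≤ Real.log (H + 1) := Real.log_le_log (by linarith) (by linarith)
  have h3 : Real.log 2 ≤ Real.log (H + 1) := Real.log_le_log (by norm_num) (by linarith)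
  linarith [Real.log_two_gt_d9]

lemma sum_nonzeroPairs_weight_le {H : ℕ} (hH : 1 ≤ H) :
    ∑ ab ∈ nonzeroPairs H, 1 / (max |(ab.1 : ℝ)| 1 * max |(ab.2 : ℝ)| 1) ≤
      64 * Real.log (H + 1) ^ 2 := by
  have h0 : 0 ≤ ∑ m ∈ Finset.Icc (-(H : ℤ)) H, 1 / max |(m : ℝ)| 1 :=
    Finset.sum_nonneg fun _ _ => by positivity
  calc ∑ ab ∈ nonzeroPairs H, 1 / (max |(ab.1 : ℝ)| 1 * max |(ab.2 : ℝ)| 1)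
      ≤ ∑ ab ∈ Finset.Icc (-(H : ℤ)) H ×ˢ Finset.Icc (-(H : ℤ)) H,
        1 / (max |(ab.1 : ℝ)| 1 * max |(ab.2 : ℝ)| 1) :=
        Finset.sum_le_sum_of_subset_of_nonneg (Finset.erase_subset _ _) fun _ _ _ => by positivity
    _ = (∑ m ∈ Finset.Icc (-(H : ℤ)) H, 1 / max |(m : ℝ)| 1) *
        ∑ m ∈ Finset.Icc (-(H : ℤ)) H, 1 / max |(m : ℝ)| 1 := by
        rw [Finset.sum_mul_sum, Finset.sum_product]
        refine Finset.sum_congr rfl fun a _ => Finset.sum_congr rfl fun b _ => ?_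
        simp only
        rw [one_div_mul_one_div]
    _ ≤ (8 * Real.log (H + 1)) * (8 * Real.log (H + 1)) := by
        have := sum_Icc_one_div_max_le hH
        exact mul_le_mul this this h0 (h0.trans this)
    _ = _ := by ring

/-- The Gaussian weight of the frequency pair `ab` at the pair of inputs `z`. -/
noncomputable def gaussWeight (R : ℝ) (ab : ℤ × ℤ) (z : ℝ × ℝ) : ℝ :=
  Real.exp (-2 * Real.pi ^ 2 * R ^ 2 * ((ab.1 : ℝ) * z.1 + (ab.2 : ℝ) * z.2) ^ 2)

lemma gaussWeight_pos (R : ℝ) (ab : ℤ × ℤ) (z : ℝ × ℝ) : 0 < gaussWeight R ab z := Real.exp_pos _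

lemma gaussWeight_le_one (R : ℝ) (ab : ℤ × ℤ) (z : ℝ × ℝ) : gaussWeight R ab z ≤ 1 := by
  unfold gaussWeight
  rw [Real.exp_le_one_iff]
  have : 0 ≤ Real.pi ^ 2 * R ^ 2 * ((ab.1 : ℝ) * z.1 + (ab.2 : ℝ) * z.2) ^ 2 := by positivity
  linarith

@[fun_prop] lemma continuous_gaussWeight (R : ℝ) (ab : ℤ × ℤ) : Continuous (gaussWeight R ab) := by
  unfold gaussWeight
  fun_prop

lemma integrable_gaussWeight (ν : Measure (ℝ × ℝ)) [IsFiniteMeasure ν] (R : ℝ) (ab : ℤ × ℤ) :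
    Integrable (gaussWeight R ab) ν :=
  Integrable.of_bound (continuous_gaussWeight R ab).measurable.aestronglyMeasurable 1
    (ae_of_all _ fun z => by
      rw [Real.norm_eq_abs, abs_of_pos (gaussWeight_pos R ab z)]
      exact gaussWeight_le_one R ab z)

/-- The weighted sum over nonzero frequency pairs of the Gaussian weights. -/
noncomputable def gaussWeightSum (R : ℝ) (H : ℕ) (z : ℝ × ℝ) : ℝ :=
  ∑ ab ∈ nonzeroPairs H, gaussWeight R ab z / (max |(ab.1 : ℝ)| 1 * max |(ab.2 : ℝ)| 1)

lemma gaussWeightSum_nonneg (R : ℝ) (H : ℕ) (z : ℝ × ℝ) : 0 ≤ gaussWeightSum R H z :=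
  Finset.sum_nonneg fun ab _ => div_nonneg (gaussWeight_pos R ab z).le (by positivity)

@[fun_prop] lemma continuous_gaussWeightSum (R : ℝ) (H : ℕ) : Continuous (gaussWeightSum R H) := by
  unfold gaussWeightSum
  fun_prop

lemma integrable_gaussWeightSum (ν : Measure (ℝ × ℝ)) [IsFiniteMeasure ν] (R : ℝ) (H : ℕ) :
    Integrable (gaussWeightSum R H) ν :=
  integrable_finsetSum _ fun ab _ => (integrable_gaussWeight ν R ab).div_const _

/-- Cauchy–Schwarz against the weights, whose total is at most `64 log²(H+1)`, together with the
fact that a number in `[0, 1]` dominates its square. The squared discrepancy becomes linear in the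
Gaussian exponentials. -/
lemma gaussWeightSum_sq_le (R : ℝ) {H : ℕ} (hH : 1 ≤ H) (z : ℝ × ℝ) :
    gaussWeightSum R H z ^ 2 ≤ 64 * Real.log (H + 1) ^ 2 * gaussWeightSum R H z := by
  have h1 : gaussWeightSum R H z ^ 2 ≤
      (∑ ab ∈ nonzeroPairs H, 1 / (max |(ab.1 : ℝ)| 1 * max |(ab.2 : ℝ)| 1)) *
        gaussWeightSum R H z := by
    refine Finset.sum_sq_le_sum_mul_sum_of_sq_le_mul _ (fun _ _ => by positivity)
      (fun ab _ => div_nonneg (gaussWeight_pos R ab z).le (by positivity)) fun ab _ => ?_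
    have g0 := (gaussWeight_pos R ab z).le
    have g1 := gaussWeight_le_one R ab z
    rw [div_pow, div_mul_div_comm, one_mul, ← sq]
    gcongr
    nlinarith
  exact h1.trans (mul_le_mul_of_nonneg_right (sum_nonzeroPairs_weight_le hH)
    (gaussWeightSum_nonneg R H z))

lemma discrepancyBound_eq (μ : Measure ℝ) [IsProbabilityMeasure μ] (R : ℝ) (H : ℕ) :
    discrepancyBound μ R H = 1 / (H : ℝ) ^ 2 + Real.log ((H : ℝ) + 1) ^ 2 *
      ∫ z, gaussWeightSum R H z ∂(μ.prod μ) := by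
  unfold discrepancyBound gaussWeightSum
  rw [integral_finsetSum _ fun ab _ => (integrable_gaussWeight _ R ab).div_const _]
  congr 2
  refine Finset.sum_congr rfl fun ab _ => ?_
  rw [integral_div]
  rfl

lemma discrepancyBound_nonneg (μ : Measure ℝ) [IsProbabilityMeasure μ] (R : ℝ) (H : ℕ) :
    0 ≤ discrepancyBound μ R H := by
  rw [discrepancyBound_eq]
  have : 0 ≤ ∫ z, gaussWeightSum R H z ∂(μ.prod μ) := integral_nonneg (gaussWeightSum_nonneg R H)
  positivity

lemma integral_sq_add_gaussWeightSum_le (μ : Measure ℝ) [IsProbabilityMeasure μ] (R : ℝ) {H : ℕ}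
    (hH : 1 ≤ H) :
    ∫ z, (1 / (H : ℝ) + gaussWeightSum R H z) ^ 2 ∂(μ.prod μ) ≤ 128 * discrepancyBound μ R H := by
  have hint := integrable_gaussWeightSum (μ.prod μ) R H
  calc ∫ z, (1 / (H : ℝ) + gaussWeightSum R H z) ^ 2 ∂(μ.prod μ)
      ≤ ∫ z, (2 * (1 / (H : ℝ) ^ 2) + 128 * Real.log (H + 1) ^ 2 * gaussWeightSum R H z)
          ∂(μ.prod μ) := by
        refine integral_mono_of_nonneg (ae_of_all _ fun z => sq_nonneg _)
          ((integrable_const _).add (hint.const_mul _)) (ae_of_all _ fun z => ?_)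
        have h1 := gaussWeightSum_sq_le R hH z
        have h2 := sq_nonneg (1 / (H : ℝ) - gaussWeightSum R H z)
        have h3 : (1 / (H : ℝ)) ^ 2 = 1 / (H : ℝ) ^ 2 := by rw [div_pow, one_pow]
        simp only
        nlinarith
    _ = 2 * (1 / (H : ℝ) ^ 2) + 128 * Real.log (H + 1) ^ 2 *
          ∫ z, gaussWeightSum R H z ∂(μ.prod μ) := by
        rw [integral_add (integrable_const _) (hint.const_mul _), integral_const,
          integral_const_mul (128 * Real.log ((H : ℝ) + 1) ^ 2)]
        simp
    _ ≤ _ := by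
        rw [discrepancyBound_eq]
        have : 0 ≤ 1 / (H : ℝ) ^ 2 := by positivity
        linarith

instance isProbabilityMeasure_frequencyLaw (R : ℝ) : IsProbabilityMeasure (frequencyLaw R) := by
  unfold frequencyLaw
  infer_instance

/-- Each coefficient is the characteristic function of `N(0, R²)` at `2π(ax + by)`, for the
frequency pair `(a, b)`. It is real and positive, so the norm costs nothing. -/
lemma coeffSum_frequencyLaw (R : ℝ) (H : ℕ) (x y : ℝ) :
    coeffSum (frequencyLaw R) (fun a => a * x) (fun a => a * y) H = gaussWeightSum R H (x, y) := by
  unfold coeffSum gaussWeightSum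
  refine Finset.sum_congr rfl fun ab _ => ?_
  congr 1
  have h := charFun_gaussianReal (μ := 0) (v := Real.toNNReal (R ^ 2))
    (2 * Real.pi * (ab.1 * x + ab.2 * y))
  rw [charFun_apply_real] at h
  have e : ∫ a, expi (ab.1 * (a * x) + ab.2 * (a * y)) ∂(frequencyLaw R) =
      ((gaussWeight R ab (x, y) : ℝ) : ℂ) := by
    unfold frequencyLaw expi gaussWeight
    rw [Complex.ofReal_exp]
    convert h using 2
    · funext a
      congr 1
      push_cast
      ring
    · rw [Real.coe_toNNReal _ (sq_nonneg R)]
      push_cast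
      ring
  rw [e, Complex.norm_real, Real.norm_eq_abs, abs_of_pos (gaussWeight_pos _ _ _)]

/-! ### Variance over a Gaussian frequency -/

lemma integral_mul_le_sqrt_mul_sqrt {α : Type*} [MeasurableSpace α] {ν : Measure α} {f g : α → ℝ}
    (hf0 : ∀ x, 0 ≤ f x) (hg0 : ∀ x, 0 ≤ g x) (hf : MemLp f 2 ν) (hg : MemLp g 2 ν) :
    ∫ x, f x * g x ∂ν ≤ √(∫ x, f x ^ 2 ∂ν) * √(∫ x, g x ^ 2 ∂ν) := by
  have := integral_mul_le_Lp_mul_Lq_of_nonneg (μ := ν) (f := f) (g := g)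
    (p := 2) (q := 2) Real.HolderConjugate.two_two (ae_of_all _ hf0) (ae_of_all _ hg0)
    (by simpa using hf) (by simpa using hg)
  simpa [Real.sqrt_eq_rpow] using this

/-- Bound for the variance of `a ↦ E_X [Φ(X, ψ(a X)) g(X)]` for a Gaussian frequency `a`. -/
theorem variance_wave_integral_le {Φ : ℝ → ℝ → ℝ} {ψ v g : ℝ → ℝ} {V B c R : ℝ}
    (hΦ : Measurable (Function.uncurry Φ)) (hc : 0 ≤ c)
    (hΦb : ∀ x y, |Φ x y| ≤ c) (hΦl : ∀ x y y', |Φ x y - Φ x y'| ≤ c * |y - y'|)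
    (hψ : PeriodicVariation ψ v V) (hg : Measurable g) (hgb : ∀ x, |g x| ≤ B)
    (μ : Measure ℝ) [IsProbabilityMeasure μ] {H : ℕ} (hH : 1 ≤ H) :
    MemLp (fun a => ∫ x, Φ x (ψ (a * x)) * g x ∂μ) 2 (frequencyLaw R) ∧
    variance (fun a => ∫ x, Φ x (ψ (a * x)) * g x ∂μ) (frequencyLaw R) ≤
      348 * c ^ 2 * V ^ 2 * (∫ x, g x ^ 2 ∂μ) * √(discrepancyBound μ R H) := by
  have hψm := hψ.measurable
  have hV := hψ.nonneg
  have hB : 0 ≤ B := (abs_nonneg _).trans (hgb 0)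
  have hΦ' : ∀ {α : Type} [MeasurableSpace α] {s t : α → ℝ}, Measurable s → Measurable t →
      Measurable fun z => Φ (s z) (t z) := fun hs ht => hΦ.comp (hs.prodMk ht)
  set P := frequencyLaw R with hP
  set τ : Measure ℝ := volume.restrict (Ioc (-(1 / 2)) (1 / 2)) with hτ
  have hτ1 : ∀ f : ℝ → ℝ, ∫ u in (-(1 / 2) : ℝ)..(1 / 2), f u = ∫ u, f u ∂τ := fun f =>
    intervalIntegral.integral_of_le (by norm_num)
  have : IsProbabilityMeasure τ := ⟨by rw [hτ, Measure.restrict_apply_univ]; norm_num⟩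
  set m : ℝ → ℝ := fun x => ∫ u, Φ x (ψ u) ∂τ with hm
  have hmm : Measurable m := by
    have : StronglyMeasurable (Function.uncurry fun x u => Φ x (ψ u)) :=
      (hΦ' measurable_fst (hψm.comp measurable_snd)).stronglyMeasurable
    exact this.integral_prod_right.measurable
  have hmb : ∀ x, |m x| ≤ c := fun x => by
    have := norm_integral_le_of_norm_le_const (μ := τ) (f := fun u => Φ x (ψ u)) (C := c)
      (ae_of_all _ fun u => hΦb x _)
    simpa using this
  set f : ℝ → ℝ → ℝ := fun x t => Φ x (ψ t) - m x with hf
  have hfm : ∀ {α : Type} [MeasurableSpace α] {s t : α → ℝ}, Measurable s → Measurable t →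
      Measurable fun z => f (s z) (t z) := fun hs ht =>
    (hΦ' hs (hψm.comp ht)).sub (hmm.comp hs)
  have hfV : ∀ x, PeriodicVariation (f x) (fun t => c * v t) (c * V) := fun x =>
    { measurable := hfm measurable_const measurable_id
      periodic := fun t => by simp only [hf]; rw [hψ.periodic t]
      abs_sub_le := fun s t hst => by
        simp only [hf]
        rw [sub_sub_sub_cancel_right, ← mul_sub]
        exact (hΦl _ _ _).trans (mul_le_mul_of_nonneg_left (hψ.abs_sub_le s t hst) hc)
      add_one := fun t => by rw [hψ.add_one]; ring }
  have hf0 : ∀ x, ∫ u in (-(1 / 2) : ℝ)..(1 / 2), f x u = 0 := by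
    intro x
    rw [hτ1]
    simp only [hf]
    rw [integral_sub _ (integrable_const _), integral_const]
    · simp [hm]
    · exact Integrable.of_bound (hΦ' measurable_const hψm).aestronglyMeasurable c
        (ae_of_all _ fun u => hΦb x _)
  have hfb : ∀ x t, |f x t| ≤ c * V := fun x => (hfV x).abs_le_total (hf0 x)
  set G : ℝ → ℝ := fun a => ∫ x, Φ x (ψ (a * x)) * g x ∂μ with hG
  have hGm : Measurable G := by
    have : StronglyMeasurable (Function.uncurry fun a x => Φ x (ψ (a * x)) * g x) :=
      ((hΦ' measurable_snd (hψm.comp (measurable_fst.mul measurable_snd))).mul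
        (hg.comp measurable_snd)).stronglyMeasurable
    exact this.integral_prod_right.measurable
  have hGb : ∀ a, ‖G a‖ ≤ c * B := fun a => by
    have := norm_integral_le_of_norm_le_const (μ := μ) (f := fun x => Φ x (ψ (a * x)) * g x)
      (C := c * B) (ae_of_all _ fun x => by
        rw [norm_mul]
        exact mul_le_mul (hΦb _ _) (hgb x) (norm_nonneg _) hc)
    simpa using this
  refine ⟨MemLp.of_bound hGm.aestronglyMeasurable _ (ae_of_all _ hGb), ?_⟩
  -- The subtracted constant need not be the expectation of `G`, since the second moment about any
  -- point bounds the variance. The mean over a uniform phase is chosen because it makes each `f x`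
  -- mean-zero.
  have hG' : ∀ a, G a - ∫ x, m x * g x ∂μ = ∫ x, f x (a * x) * g x ∂μ := by
    intro a
    simp only [hG, hf, sub_mul]
    rw [integral_sub]
    · refine Integrable.of_bound (Measurable.aestronglyMeasurable
        ((hΦ' measurable_id (hψm.comp (measurable_const.mul measurable_id))).mul hg)) (c * B)
        (ae_of_all _ fun x => ?_)
      rw [norm_mul]
      exact mul_le_mul (hΦb _ _) (hgb x) (norm_nonneg _) hc
    · refine Integrable.of_bound (hmm.mul hg).aestronglyMeasurable (c * B)
        (ae_of_all _ fun x => ?_)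
      rw [norm_mul]
      exact mul_le_mul (hmb _) (hgb x) (norm_nonneg _) hc
  set Θ : ℝ → ℝ × ℝ → ℝ := fun a z => f z.1 (a * z.1) * g z.1 * (f z.2 (a * z.2) * g z.2) with hΘ
  have hsq : ∀ a, (G a - ∫ x, m x * g x ∂μ) ^ 2 = ∫ z, Θ a z ∂(μ.prod μ) := by
    intro a
    rw [hG', sq]
    exact (integral_prod_mul (μ := μ) (ν := μ) (fun x => f x (a * x) * g x)
      (fun x => f x (a * x) * g x)).symm
  have hΘint : Integrable (Function.uncurry Θ) (P.prod (μ.prod μ)) := by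
    refine Integrable.of_bound (Measurable.aestronglyMeasurable ?_) (c * V * B * (c * V * B))
      (ae_of_all _ fun w => ?_)
    · refine Measurable.mul (Measurable.mul (hfm ?_ ?_) ?_) (Measurable.mul (hfm ?_ ?_) ?_) <;>
        fun_prop
    · simp only [Function.uncurry, hΘ, norm_mul, Real.norm_eq_abs]
      have hcV : 0 ≤ c * V := by positivity
      gcongr
      · exact hfb _ _
      · exact hgb _
      · exact hfb _ _
      · exact hgb _
  set D : ℝ × ℝ → ℝ := fun z => 1 / (H : ℝ) + gaussWeightSum R H z with hD
  have hD0 : ∀ z, 0 ≤ D z := fun z => add_nonneg (by positivity) (gaussWeightSum_nonneg R H z)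
  have hDc : Continuous D := by fun_prop
  have hDb : ∀ z, ‖D z‖ ≤ 1 / (H : ℝ) + ∑ ab ∈ nonzeroPairs H,
      1 / (max |(ab.1 : ℝ)| 1 * max |(ab.2 : ℝ)| 1) := by
    intro z
    rw [Real.norm_eq_abs, abs_of_nonneg (hD0 z)]
    simp only [hD, gaussWeightSum]
    gcongr with ab _
    exact gaussWeight_le_one R ab z
  have hDL : MemLp D 2 (μ.prod μ) :=
    MemLp.of_bound hDc.measurable.aestronglyMeasurable _ (ae_of_all _ hDb)
  have hinner : ∀ z : ℝ × ℝ, ∫ a, Θ a z ∂P ≤ 29 * c ^ 2 * V ^ 2 * (|g z.1| * |g z.2| * D z) := by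
    intro z
    have e : ∫ a, Θ a z ∂P = (∫ a, f z.1 (a * z.1) * f z.2 (a * z.2) ∂P) * (g z.1 * g z.2) := by
      rw [← integral_mul_const]
      refine integral_congr_ae (ae_of_all _ fun a => ?_)
      simp only [hΘ]
      ring
    have k := abs_integral_mul_le_coeffSum (P := P) (S := fun a => a * z.1)
      (T := fun a => a * z.2) (hfV z.1) (hfV z.2) (hf0 z.1) (hf0 z.2)
      (measurable_id.mul_const _) (measurable_id.mul_const _) hH
    rw [hP, coeffSum_frequencyLaw] at k
    rw [e]
    refine (le_abs_self _).trans ?_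
    rw [abs_mul, abs_mul]
    refine (mul_le_mul_of_nonneg_right k (by positivity)).trans (le_of_eq ?_)
    simp only [hD]
    ring
  have hgg : MemLp (fun z : ℝ × ℝ => |g z.1| * |g z.2|) 2 (μ.prod μ) := by
    refine MemLp.of_bound (Measurable.aestronglyMeasurable (by fun_prop)) (B * B)
      (ae_of_all _ fun z => ?_)
    rw [norm_mul, Real.norm_eq_abs, Real.norm_eq_abs, abs_abs, abs_abs]
    exact mul_le_mul (hgb _) (hgb _) (abs_nonneg _) hB
  have hcs := integral_mul_le_sqrt_mul_sqrt (ν := μ.prod μ)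
    (f := fun z => |g z.1| * |g z.2|) (g := D) (fun z => by positivity) hD0 hgg hDL
  have hgsq : ∫ z : ℝ × ℝ, (|g z.1| * |g z.2|) ^ 2 ∂(μ.prod μ) = (∫ x, g x ^ 2 ∂μ) ^ 2 := by
    simp only [mul_pow, sq_abs]
    rw [integral_prod_mul (μ := μ) (ν := μ) (fun x => g x ^ 2) (fun x => g x ^ 2), sq]
  have hg0 : 0 ≤ ∫ x, g x ^ 2 ∂μ := integral_nonneg fun x => sq_nonneg _
  rw [hgsq, Real.sqrt_sq hg0] at hcs
  -- `12² = 144` exceeds the constant `128`; the final constant is `348 = 29 · 12`.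
  have hDs : √(∫ z, D z ^ 2 ∂(μ.prod μ)) ≤ 12 * √(discrepancyBound μ R H) := by
    rw [Real.sqrt_le_left (by positivity), mul_pow, Real.sq_sqrt (discrepancyBound_nonneg μ R H)]
    have := integral_sq_add_gaussWeightSum_le μ R hH
    linarith [discrepancyBound_nonneg μ R H]
  calc variance G P = variance (fun a => G a - ∫ x, m x * g x ∂μ) P :=
        (variance_sub_const hGm.aestronglyMeasurable _).symm
    _ ≤ ∫ a, (G a - ∫ x, m x * g x ∂μ) ^ 2 ∂P :=
        variance_le_expectation_sq (hGm.sub_const _).aestronglyMeasurable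
    _ = ∫ z, ∫ a, Θ a z ∂P ∂(μ.prod μ) := by
        simp_rw [hsq]
        exact integral_integral_swap hΘint
    _ ≤ ∫ z, 29 * c ^ 2 * V ^ 2 * (|g z.1| * |g z.2| * D z) ∂(μ.prod μ) :=
        integral_mono hΘint.integral_prod_right ((hgg.integrable_mul hDL).const_mul _) hinner
    _ ≤ 29 * c ^ 2 * V ^ 2 * ((∫ x, g x ^ 2 ∂μ) * (12 * √(discrepancyBound μ R H))) := by
        rw [integral_const_mul]
        gcongr
        exact hcs.trans (by gcongr)
    _ = _ := by ring

/-! ### From the assumptions to a representation of the gradient -/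

lemma exists_periodicVariation {ψ : ℝ → ℝ} (hm : Measurable ψ) (hp : Function.Periodic ψ 1)
    (hbv : BoundedVariationOn ψ (Icc (0 : ℝ) 1)) :
    ∃ v, PeriodicVariation ψ v (bvNorm ψ) := by
  set V : ℝ → ℝ := fun a => (eVariationOn ψ (Icc 0 a)).toReal with hV
  have key : ∀ a b, 0 ≤ a → a ≤ b → b ≤ 1 → |ψ b - ψ a| ≤ V b - V a := by
    intro a b ha hab hb
    have fin : ∀ x y, 0 ≤ x → y ≤ 1 → eVariationOn ψ (Icc x y) ≠ ⊤ := fun x y hx hy =>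
      ne_top_of_le_ne_top hbv (eVariationOn.mono _ (Icc_subset_Icc hx hy))
    have hadd := eVariationOn.Icc_add_Icc ψ (s := univ) ha hab (mem_univ a)
    simp only [univ_inter] at hadd
    have e : V b = V a + (eVariationOn ψ (Icc a b)).toReal := by
      simp only [hV]
      rw [← hadd, ENNReal.toReal_add (fin _ _ le_rfl (hab.trans hb)) (fin _ _ ha hb)]
    have h1 := BoundedVariationOn.dist_le (f := ψ) (s := Icc a b) (fin _ _ ha hb)
      (right_mem_Icc.2 hab) (left_mem_Icc.2 hab)
    rw [Real.dist_eq] at h1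
    linarith
  have V0 : V 0 = 0 := by simp [hV]
  have V1 : V 1 = bvNorm ψ := rfl
  have hper : ∀ x, ψ (Int.fract x) = ψ x := fun x => by
    have := hp.sub_int_mul_eq (x := x) ⌊x⌋
    rwa [mul_one] at this
  refine ⟨fun t => ⌊t⌋ * bvNorm ψ + V (Int.fract t), hm, hp, fun s t hst => ?_, fun t => ?_⟩
  · have fs0 := Int.fract_nonneg s
    have fs1 := (Int.fract_lt_one s).le
    have ft0 := Int.fract_nonneg t
    have ft1 := (Int.fract_lt_one t).le
    rw [← hper s, ← hper t]
    rcases (Int.floor_le_floor hst).eq_or_lt with hfl | hfl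
    · rw [hfl]
      have : Int.fract s ≤ Int.fract t := by
        unfold Int.fract
        rw [hfl]
        linarith
      linarith [key _ _ fs0 this ft1]
    -- When the integer parts differ, the path runs from `fract s` up to `1`, then from `0` to
    -- `fract t`, using `ψ 1 = ψ 0`. Further whole periods only add to the increment of `v`.
    · have k1 := key _ _ le_rfl ft0 ft1
      have k2 := key _ _ fs0 fs1 le_rfl
      have h01 : ψ 1 = ψ 0 := by simpa using hp 0
      have hb0 : 0 ≤ bvNorm ψ := ENNReal.toReal_nonneg
      have hfl' : (⌊s⌋ : ℝ) + 1 ≤ ⌊t⌋ := by exact_mod_cast hfl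
      have tri : |ψ (Int.fract t) - ψ (Int.fract s)| ≤
          |ψ (Int.fract t) - ψ 0| + |ψ 1 - ψ (Int.fract s)| := by
        rw [h01]
        exact abs_sub_le _ _ _
      nlinarith
  · rw [Int.floor_add_one, Int.fract_add_one]
    push_cast
    ring

/-- A jointly measurable, bounded, Lipschitz family `Φ` and a bounded measurable `g` that represent
the partial derivatives of the objective. -/
lemma exists_representation {N : ℕ} {O : Set (EuclideanSpace ℝ (Fin N))}
    {p : EuclideanSpace ℝ (Fin N) → ℝ → ℝ} {L : ℝ → ℝ → ℝ} {ψ : ℝ → ℝ} {μ : Measure ℝ}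
    [IsProbabilityMeasure μ] {i : Fin N} {w : EuclideanSpace ℝ (Fin N)} {c : ℝ} (hc : 0 ≤ c)
    (hA : StandingAssumptions O p L ψ μ) (hw : w ∈ O) (hD : DerivativeBounds p L μ i w c) :
    ∃ (Φ : ℝ → ℝ → ℝ) (g : ℝ → ℝ) (B : ℝ), Measurable (Function.uncurry Φ) ∧ Measurable g ∧
      (∀ x, |g x| ≤ B) ∧ (∀ x y, |Φ x y| ≤ c) ∧
      (∀ x y y', |Φ x y - Φ x y'| ≤ c * |y - y'|) ∧
      (∀ a, HasLineDerivAt ℝ (objective L p μ (waveTarget ψ a))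
        (∫ x, Φ x (ψ (a * x)) * g x ∂μ) w (EuclideanSpace.single i (1 : ℝ))) ∧
      sqNormPartial p μ i w = ∫ x, g x ^ 2 ∂μ := by
  obtain ⟨B, hB⟩ := hA.bounded_loss
  obtain ⟨K, hK⟩ := hA.lipschitz
  obtain ⟨U, hU, hlip⟩ := hK w hw
  have hL := hA.measurable_L
  have hψ := hA.measurable_ψ
  set e : EuclideanSpace ℝ (Fin N) := EuclideanSpace.single i (1 : ℝ) with he
  have hnorm : ‖e‖ = 1 := by simp [he]
  have hγ : Continuous fun t : ℝ => w + t • e := by fun_prop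
  have hnhds : (fun t : ℝ => w + t • e) ⁻¹' (U ∩ O) ∈ 𝓝 (0 : ℝ) := by
    apply hγ.continuousAt.preimage_mem_nhds
    simp only [zero_smul, add_zero]
    exact inter_mem hU (hA.isOpen.mem_nhds hw)
  obtain ⟨ε, hε, hball⟩ := Metric.mem_nhds_iff.1 hnhds
  have hpm : ∀ w' ∈ O, Measurable (p w') := fun w' h' =>
    hA.measurable_p.comp (measurable_const.prodMk measurable_id (f := fun _ => (⟨w', h'⟩ : O)))
  set gp : ℝ → ℝ := fun x => partialDeriv (fun v => p v x) i w with hgp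
  have hpd : ∀ᵐ x ∂μ, HasDerivAt (fun t : ℝ => p (w + t • e) x) (gp x) 0 := by
    filter_upwards [hD] with x hx
    exact hx.1.hasLineDerivAt
  have hplip : ∀ᵐ x ∂μ, ∀ t ∈ Metric.ball (0 : ℝ) ε, ∀ t' ∈ Metric.ball (0 : ℝ) ε,
      |p (w + t • e) x - p (w + t' • e) x| ≤ K * |t - t'| := by
    filter_upwards [hlip] with x hx t ht t' ht'
    have := hx.1.dist_le_mul _ (hball ht).1 _ (hball ht').1
    rw [Real.dist_eq, dist_add_left, dist_eq_norm, ← sub_smul, norm_smul, hnorm, mul_one] at this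
    exact this
  have hgpK : ∀ᵐ x ∂μ, |gp x| ≤ K := by
    filter_upwards [hpd, hplip] with x h1 h2
    refine h1.le_of_lip' K.coe_nonneg ?_
    filter_upwards [Metric.ball_mem_nhds (0 : ℝ) hε] with t ht
    exact h2 t ht 0 (Metric.mem_ball_self hε)
  have hgpm : AEMeasurable gp μ := by
    -- Measurability of `p` is only available at parameters in `O`, so the steps must stay in the
    -- open ball of radius `ε`. The `+ 2` keeps the first one strictly inside.
    set u : ℕ → ℝ := fun n => ε / ((n : ℝ) + 2) with hu
    have hu0 : ∀ n, 0 < u n := fun n => by positivity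
    have hub : ∀ n, u n ∈ Metric.ball (0 : ℝ) ε := fun n => by
      rw [Metric.mem_ball, Real.dist_eq, sub_zero, abs_of_pos (hu0 n), hu]
      rw [div_lt_iff₀ (by positivity)]
      have : (0 : ℝ) ≤ n := Nat.cast_nonneg n
      nlinarith
    have hulim : Tendsto u atTop (𝓝[≠] 0) := by
      refine tendsto_nhdsWithin_iff.2 ⟨?_, Eventually.of_forall fun n => (hu0 n).ne'⟩
      exact tendsto_const_nhds.div_atTop
        (tendsto_atTop_add_const_right _ _ tendsto_natCast_atTop_atTop)
    refine aemeasurable_of_tendsto_metrizable_ae atTop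
      (f := fun n x => (u n)⁻¹ * (p (w + (0 + u n) • e) x - p (w + (0 : ℝ) • e) x)) (fun n => ?_) ?_
    · refine Measurable.aemeasurable (Measurable.const_mul (Measurable.sub ?_ ?_) _)
      · rw [zero_add]; exact hpm _ (hball (hub n)).2
      · rw [zero_smul, add_zero]; exact hpm _ hw
    · filter_upwards [hpd] with x hx
      exact hx.tendsto_slope_zero.comp hulim
  -- Clipping a measurable version at the Lipschitz constant makes it bounded everywhere and changes
  -- it only on a null set.
  set g : ℝ → ℝ := fun x => max (-(K : ℝ)) (min (hgpm.mk gp x) K) with hg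
  have hgm : Measurable g := measurable_const.max (hgpm.measurable_mk.min measurable_const)
  have hgK : ∀ x, |g x| ≤ K := fun x => by
    have := K.coe_nonneg
    exact abs_le.2 ⟨le_max_left _ _, max_le (by linarith) (min_le_right _ _)⟩
  have hgg : gp =ᵐ[μ] g := by
    filter_upwards [hgpm.ae_eq_mk, hgpK] with x h1 h2
    simp only [hg]
    rw [← h1, min_eq_left (abs_le.1 h2).2, max_eq_right (abs_le.1 h2).1]
  obtain ⟨S, hSae, hSm, hS⟩ := hD.exists_measurable_mem
  -- Setting `Φ` to zero off a measurable set of full measure turns the almost-everywhere bounds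
  -- into bounds at every `x`. It also makes `Φ` a pointwise limit of jointly measurable difference
  -- quotients.
  set Φ : ℝ → ℝ → ℝ := fun x y => S.indicator (fun x => lossDeriv L (p w x) y) x with hΦ
  have hΦS : ∀ x ∈ S, ∀ y, Φ x y = lossDeriv L (p w x) y := fun x hx y => indicator_of_mem hx _
  have hΦS' : ∀ x ∉ S, ∀ y, Φ x y = 0 := fun x hx y => indicator_of_notMem hx _
  refine ⟨Φ, g, K, ?_, hgm, hgK, ?_, ?_, ?_, ?_⟩
  · obtain ⟨u, hulim⟩ := exists_seq_tendsto (𝓝[≠] (0 : ℝ))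
    have hpw := hpm w hw
    refine measurable_of_tendsto_metrizable (f := fun n => (Prod.fst ⁻¹' S).indicator fun z : ℝ × ℝ =>
      (u n)⁻¹ * (L (p w z.1 + u n) z.2 - L (p w z.1) z.2)) (fun n => ?_) ?_
    · refine Measurable.indicator ?_ (measurable_fst hSm)
      refine Measurable.const_mul (Measurable.sub ?_ ?_) _
      · exact hL.comp (Measurable.prodMk ((hpw.comp measurable_fst).add_const _) measurable_snd)
      · exact hL.comp (Measurable.prodMk (hpw.comp measurable_fst) measurable_snd)
    · refine tendsto_pi_nhds.2 fun z => ?_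
      by_cases hz : z.1 ∈ S
      · have hz' : z ∈ Prod.fst ⁻¹' S := hz
        simp only [indicator_of_mem hz', Function.uncurry, hΦS _ hz]
        exact ((hS z.1 hz).2.1 z.2).hasDerivAt.tendsto_slope_zero.comp hulim
      · have hz' : z ∉ Prod.fst ⁻¹' S := hz
        simp only [indicator_of_notMem hz', Function.uncurry, hΦS' _ hz]
        exact tendsto_const_nhds
  · intro x y
    by_cases hx : x ∈ S
    · rw [hΦS x hx]
      exact (hS x hx).2.2.2.2.1 y
    · rw [hΦS' x hx, abs_zero]
      exact hc
  · intro x y y'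
    by_cases hx : x ∈ S
    · rw [hΦS x hx, hΦS x hx]
      have := convex_univ.norm_image_sub_le_of_norm_deriv_le (𝕜 := ℝ)
        (f := fun y => lossDeriv L (p w x) y) (C := c) (fun y _ => (hS x hx).2.2.1 y)
        (fun y _ => (hS x hx).2.2.2.2.2.1 y) (mem_univ y') (mem_univ y)
      exact this
    · rw [hΦS' x hx, hΦS' x hx, sub_zero, abs_zero]
      positivity
  · intro a
    have hψa : Measurable fun x => ψ (a * x) := hψ.comp (measurable_const.mul measurable_id)
    have hFm : ∀ w' ∈ O, Measurable fun x => L (p w' x) (waveTarget ψ a x) := fun w' h' =>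
      hL.comp ((hpm w' h').prodMk hψa)
    have hFeq : ∀ᵐ x ∂μ, Φ x (ψ (a * x)) * g x =
        lossDeriv L (p w x) (waveTarget ψ a x) * gp x := by
      filter_upwards [hgg, hSae] with x h1 h2
      rw [hΦS x h2, h1]
      rfl
    have hΦm : AEStronglyMeasurable (fun x => Φ x (ψ (a * x)) * g x) μ := by
      have hpw := hpm w hw
      have hbase : AEMeasurable (fun x => lossDeriv L (p w x) (waveTarget ψ a x)) μ := by
        obtain ⟨u, hulim⟩ := exists_seq_tendsto (𝓝[≠] (0 : ℝ))
        refine aemeasurable_of_tendsto_metrizable_ae atTop (f := fun n x =>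
          (u n)⁻¹ * (L (p w x + u n) (waveTarget ψ a x) - L (p w x) (waveTarget ψ a x)))
          (fun n => ?_) ?_
        · refine Measurable.aemeasurable (Measurable.const_mul (Measurable.sub ?_ ?_) _)
          · exact hL.comp ((hpw.add_const _).prodMk hψa)
          · exact hL.comp (hpw.prodMk hψa)
        · filter_upwards [hD] with x hx
          exact (hx.2.1 _).hasDerivAt.tendsto_slope_zero.comp hulim
      exact ((hbase.mul hgpm).congr (hFeq.mono fun x hx => hx.symm)).aestronglyMeasurable
    have main := hasDerivAt_integral_of_dominated_loc_of_lip (μ := μ) (𝕜 := ℝ)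
      (F := fun t x => L (p (w + t • e) x) (waveTarget ψ a x)) (x₀ := 0)
      (s := Metric.ball 0 ε) (F' := fun x => Φ x (ψ (a * x)) * g x)
      (bound := fun _ => (K : ℝ) * K)
      (Metric.ball_mem_nhds 0 hε) ?_ ?_ hΦm ?_ (integrable_const _) ?_
    · exact main.2
    · filter_upwards [Metric.ball_mem_nhds (0 : ℝ) hε] with t ht
      exact (hFm _ (hball ht).2).aestronglyMeasurable
    · simp only [zero_smul, add_zero]
      exact Integrable.of_bound (hFm w hw).aestronglyMeasurable B
        (ae_of_all _ fun x => hB w hw x a)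
    · filter_upwards [hplip, hlip] with x h1 h2
      refine LipschitzOnWith.of_dist_le_mul fun t ht t' ht' => ?_
      have h3 := (h2.2 (waveTarget ψ a x)).dist_le_mul _ (mem_image_of_mem _ (hball ht).1)
        _ (mem_image_of_mem _ (hball ht').1)
      have h4 := h1 t ht t' ht'
      rw [Real.coe_nnabs, abs_of_nonneg (mul_nonneg K.coe_nonneg K.coe_nonneg), mul_assoc]
      refine h3.trans (mul_le_mul_of_nonneg_left ?_ K.coe_nonneg)
      simpa [Real.dist_eq] using h4
    · filter_upwards [hpd, hD, hFeq] with x h1 h2 h3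
      rw [h3]
      have h4 : HasDerivAt (fun q => L q (waveTarget ψ a x))
          (lossDeriv L (p w x) (waveTarget ψ a x)) (p (w + (0 : ℝ) • e) x) := by
        rw [zero_smul, add_zero]
        exact (h2.2.1 _).hasDerivAt
      exact h4.comp (0 : ℝ) h1
  · unfold sqNormPartial
    refine integral_congr_ae ?_
    filter_upwards [hgg] with x hx
    rw [← hx]

/-! ### Uniform inputs -/

lemma setIntegral_exp_affine_le {R a : ℝ} (hR : 0 < R) (ha : 1 ≤ |a|) (d : ℝ) :
    ∫ x in Icc (0 : ℝ) 1, Real.exp (-2 * Real.pi ^ 2 * R ^ 2 * (a * x + d) ^ 2) ≤ 1 / R := by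
  have ha0 : a ≠ 0 := fun h => by simp [h] at ha; linarith
  set b : ℝ := 2 * Real.pi ^ 2 * R ^ 2 with hb
  have hb0 : 0 < b := by positivity
  have hf : ∀ x, Real.exp (-2 * Real.pi ^ 2 * R ^ 2 * (a * x + d) ^ 2) =
      (fun u => Real.exp (-b * (u + d) ^ 2)) (a * x) := by
    intro x
    simp only [hb]
    congr 1
    ring
  simp_rw [hf]
  have hint : Integrable (fun u => Real.exp (-b * (u + d) ^ 2)) :=
    (integrable_exp_neg_mul_sq hb0).comp_add_right d
  have hint' := hint.comp_mul_left' ha0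
  refine (setIntegral_le_integral hint' (ae_of_all _ fun x => (Real.exp_pos _).le)).trans ?_
  rw [Measure.integral_comp_mul_left (fun u => Real.exp (-b * (u + d) ^ 2)), integral_add_right_eq_self (fun u => Real.exp (-b * u ^ 2)),
    integral_gaussian, smul_eq_mul]
  have h1 : |a⁻¹| ≤ 1 := by
    rw [abs_inv]
    exact inv_le_one_of_one_le₀ ha
  have h2 : √(Real.pi / b) ≤ 1 / R := by
    rw [Real.sqrt_le_left (by positivity), hb, div_pow, one_pow,
      div_le_div_iff₀ (by positivity) (by positivity)]
    nlinarith [Real.pi_gt_three, mul_pos Real.pi_pos (pow_pos hR 2)]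
  calc |a⁻¹| * √(Real.pi / b) ≤ 1 * (1 / R) := by gcongr
    _ = 1 / R := one_mul _

/-- Integrating first in a variable with nonzero integer coefficient leaves a Gaussian integral of
size at most `1/R`, uniformly in the other variable. -/
lemma integral_gaussWeight_uniform_le {R : ℝ} (hR : 0 < R) {ab : ℤ × ℤ} (hab : ab ≠ (0, 0)) :
    ∫ z, gaussWeight R ab z ∂((volume.restrict (Icc (0 : ℝ) 1)).prod
      (volume.restrict (Icc (0 : ℝ) 1))) ≤ 1 / R := by
  set μ : Measure ℝ := volume.restrict (Icc (0 : ℝ) 1) with hμ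
  have : IsProbabilityMeasure μ := ⟨by rw [hμ, Measure.restrict_apply_univ]; norm_num⟩
  have hint := integrable_gaussWeight (μ.prod μ) R ab
  have hone : ∀ n : ℤ, n ≠ 0 → (1 : ℝ) ≤ |(n : ℝ)| := fun n hn => by
    exact_mod_cast Int.one_le_abs hn
  by_cases ha : ab.1 = 0
  · have hb : ab.2 ≠ 0 := fun h => hab (Prod.ext ha h)
    rw [integral_prod _ hint]
    calc ∫ x, ∫ y, gaussWeight R ab (x, y) ∂μ ∂μ ≤ ∫ _, 1 / R ∂μ := by
          refine integral_mono hint.integral_prod_left (integrable_const _) fun x => ?_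
          have := setIntegral_exp_affine_le hR (hone _ hb) (ab.1 * x)
          simp only [gaussWeight]
          simp_rw [add_comm ((ab.1 : ℝ) * x)]
          exact this
      _ = 1 / R := by simp
  · rw [integral_prod_symm _ hint]
    calc ∫ y, ∫ x, gaussWeight R ab (x, y) ∂μ ∂μ ≤ ∫ _, 1 / R ∂μ := by
          refine integral_mono hint.integral_prod_right (integrable_const _) fun y => ?_
          exact setIntegral_exp_affine_le hR (hone _ ha) (ab.2 * y)
      _ = 1 / R := by simp

lemma sqrt_discrepancyBound_uniform_le {R : ℝ} (hR : 1 ≤ R) :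
    √(discrepancyBound (volume.restrict (Icc (0 : ℝ) 1)) R ⌈R⌉₊) ≤
      46 * (Real.log (R + 1) ^ 2 / √(R + 1)) := by
  have hR0 : 0 < R := by linarith
  set H := ⌈R⌉₊ with hH
  have hRH : R ≤ H := Nat.le_ceil R
  have hHR : (H : ℝ) < R + 1 := Nat.ceil_lt_add_one hR0.le
  have hH1 : 1 ≤ H := by
    have : (1 : ℝ) ≤ H := hR.trans hRH
    exact_mod_cast this
  set ℓ := Real.log (R + 1) with hℓ
  have hlog2 : Real.log 2 ≤ ℓ := Real.log_le_log (by norm_num) (by linarith)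
  have hℓ1 : 0.69 ≤ ℓ := by linarith [Real.log_two_gt_d9]
  have hlogH0 : 0 ≤ Real.log ((H : ℝ) + 1) := Real.log_nonneg (by linarith)
  have hlogH : Real.log ((H : ℝ) + 1) ≤ 2 * ℓ := by
    have : 2 * ℓ = Real.log ((R + 1) ^ 2) := by rw [Real.log_pow]; norm_num [hℓ]
    rw [this]
    exact Real.log_le_log (by linarith) (by nlinarith)
  have hsum : ∑ ab ∈ nonzeroPairs H,
      (∫ z, gaussWeight R ab z ∂((volume.restrict (Icc (0 : ℝ) 1)).prod
        (volume.restrict (Icc (0 : ℝ) 1)))) / (max |(ab.1 : ℝ)| 1 * max |(ab.2 : ℝ)| 1) ≤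
      1 / R * (64 * Real.log ((H : ℝ) + 1) ^ 2) := by
    refine le_trans ?_ (mul_le_mul_of_nonneg_left (sum_nonzeroPairs_weight_le hH1) (by positivity))
    rw [Finset.mul_sum]
    refine Finset.sum_le_sum fun ab hab => ?_
    rw [mul_one_div]
    gcongr
    exact integral_gaussWeight_uniform_le hR0 (Finset.ne_of_mem_erase hab)
  have hdisc : discrepancyBound (volume.restrict (Icc (0 : ℝ) 1)) R H ≤
      1 / R * (1 + 1024 * ℓ ^ 4) := by
    have h1 : 1 / (H : ℝ) ^ 2 ≤ 1 / R := by
      apply one_div_le_one_div_of_le hR0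
      nlinarith
    have h2 : Real.log ((H : ℝ) + 1) ^ 2 ≤ 4 * ℓ ^ 2 := by nlinarith
    calc discrepancyBound (volume.restrict (Icc (0 : ℝ) 1)) R H
        ≤ 1 / R + Real.log ((H : ℝ) + 1) ^ 2 * (1 / R * (64 * Real.log ((H : ℝ) + 1) ^ 2)) :=
          add_le_add h1 (mul_le_mul_of_nonneg_left hsum (sq_nonneg _))
      _ ≤ 1 / R + 4 * ℓ ^ 2 * (1 / R * (64 * (4 * ℓ ^ 2))) := by gcongr
      _ = _ := by ring
  rw [Real.sqrt_le_left (by positivity)]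
  refine hdisc.trans ?_
  rw [mul_pow, div_pow, Real.sq_sqrt (by linarith), ← pow_mul, ← mul_div_assoc, one_div,
    inv_mul_eq_div, div_le_div_iff₀ hR0 (by linarith)]
  norm_num
  have h4 : 1 ≤ 5 * ℓ ^ 4 := by
    have : (0.69 : ℝ) ^ 4 ≤ ℓ ^ 4 := by gcongr
    norm_num at this
    linarith
  -- With `R + 1 ≤ 2R` the constant becomes `2058`, below `46² = 2116`.
  have h5 : 1 + 1024 * ℓ ^ 4 ≤ 1029 * ℓ ^ 4 := by linarith
  calc (1 + 1024 * ℓ ^ 4) * (R + 1) ≤ (1029 * ℓ ^ 4) * (2 * R) := by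
        gcongr
        linarith
    _ ≤ 2116 * ℓ ^ 4 * R := by
        have : 0 ≤ ℓ ^ 4 * R := by positivity
        linarith

/-! ### Assembly -/

theorem theorem5 :
    ∀ c : ℝ, 0 < c → ∃ α : ℝ, 0 < α ∧
      ∀ (N : ℕ) (O : Set (EuclideanSpace ℝ (Fin N)))
        (p : EuclideanSpace ℝ (Fin N) → ℝ → ℝ) (L : ℝ → ℝ → ℝ) (ψ : ℝ → ℝ)
        (μ : Measure ℝ) [IsProbabilityMeasure μ] (R : ℝ) (i : Fin N)
        (w : EuclideanSpace ℝ (Fin N)),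
        StandingAssumptions O p L ψ μ →
        BoundedVariationOn ψ (Set.Icc (0 : ℝ) 1) →
        μ ≪ volume → 0 < R → w ∈ O → DerivativeBounds p L μ i w c →
        (∀ a : ℝ, HasPartial (objective L p μ (waveTarget ψ a)) i w) ∧
        MemLp (gradCoord L p μ ψ i w) 2 (frequencyLaw R) ∧
        variance (gradCoord L p μ ψ i w) (frequencyLaw R) ≤
          α * sqNormPartial p μ i w * max (bvNorm ψ) (bvNorm ψ ^ 2) *
            ⨅ H : ℕ+, Real.sqrt (discrepancyBound μ R H) ∧
        (μ = volume.restrict (Set.Icc (0 : ℝ) 1) → 1 ≤ R →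
          variance (gradCoord L p μ ψ i w) (frequencyLaw R) ≤
            α * sqNormPartial p μ i w * max (bvNorm ψ) (bvNorm ψ ^ 2) *
              (Real.log (R + 1) ^ 2 / Real.sqrt (R + 1))) := by
  intro c hc
  -- `16008 = 348 · 46`: the general bound uses only `348`, and the uniform case with `H = ⌈R⌉`
  -- costs the extra factor `46`.
  refine ⟨16008 * c ^ 2, by positivity, ?_⟩
  intro N O p L ψ μ _ R i w hA hbv _ hR hw hD
  obtain ⟨v, hv⟩ := exists_periodicVariation hA.measurable_ψ hA.periodic_ψ hbv
  obtain ⟨Φ, g, B, hΦ, hg, hgb, hΦb, hΦl, hder, hnorm⟩ := exists_representation hc.le hA hw hD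
  have hgrad : gradCoord L p μ ψ i w = fun a => ∫ x, Φ x (ψ (a * x)) * g x ∂μ :=
    funext fun a => (hder a).lineDeriv
  have hvar := fun (H : ℕ) (hH : 1 ≤ H) =>
    variance_wave_integral_le (R := R) hΦ hc.le hΦb hΦl hv hg hgb μ hH
  rw [← hgrad, ← hnorm] at hvar
  have hs : 0 ≤ sqNormPartial p μ i w := by
    rw [hnorm]
    exact integral_nonneg fun x => sq_nonneg _
  have hmax : bvNorm ψ ^ 2 ≤ max (bvNorm ψ) (bvNorm ψ ^ 2) := le_max_right _ _
  have hmax0 : 0 ≤ max (bvNorm ψ) (bvNorm ψ ^ 2) := (sq_nonneg _).trans hmax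
  have hvar' : ∀ H : ℕ, 1 ≤ H → variance (gradCoord L p μ ψ i w) (frequencyLaw R) ≤
      348 * c ^ 2 * sqNormPartial p μ i w * max (bvNorm ψ) (bvNorm ψ ^ 2) *
        √(discrepancyBound μ R H) := by
    intro H hH
    calc variance (gradCoord L p μ ψ i w) (frequencyLaw R)
        ≤ 348 * c ^ 2 * bvNorm ψ ^ 2 * sqNormPartial p μ i w * √(discrepancyBound μ R H) :=
          (hvar H hH).2
      _ = 348 * c ^ 2 * sqNormPartial p μ i w * bvNorm ψ ^ 2 * √(discrepancyBound μ R H) := by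
          ring
      _ ≤ _ := by gcongr
  refine ⟨fun a => (hder a).lineDifferentiableAt, (hvar 1 le_rfl).1, ?_, ?_⟩
  · rw [Real.mul_iInf_of_nonneg (by positivity)]
    refine le_ciInf fun H => (hvar' H H.2).trans ?_
    gcongr
    norm_num
  · intro hμ hR1
    have hH : 1 ≤ ⌈R⌉₊ := Nat.one_le_iff_ne_zero.2 (Nat.ceil_pos.2 hR).ne'
    refine (hvar' ⌈R⌉₊ hH).trans ?_
    rw [hμ]
    calc 348 * c ^ 2 * sqNormPartial p (volume.restrict (Set.Icc (0 : ℝ) 1)) i w *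
          max (bvNorm ψ) (bvNorm ψ ^ 2) *
          √(discrepancyBound (volume.restrict (Set.Icc (0 : ℝ) 1)) R ⌈R⌉₊)
        ≤ 348 * c ^ 2 * sqNormPartial p (volume.restrict (Set.Icc (0 : ℝ) 1)) i w *
          max (bvNorm ψ) (bvNorm ψ ^ 2) * (46 * (Real.log (R + 1) ^ 2 / √(R + 1))) := by
          have := sqrt_discrepancyBound_uniform_le hR1
          rw [hμ] at hs
          gcongr
      _ = _ := by ring
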